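/- Let $n\ge 1$ and let $\mathbb{R}^n$ carry the $\ell^\infty$ metric $|x-y|$. Let $\mu$ be a Borel measure on $\mathbb{R}^n$ such that $\mu(B(x,r))\le\lambda(x,r)$ for all $x\in\mathbb{R}^n$, $r>0$, where $\lambda\colon\mathbb{R}^n\times(0,\infty)\to(0,\infty)$ is a function for which $r\mapsto\lambda(x,r)$ is non-decreasing and $\lambda(x,2r)\le C_\lambda\lambda(x,r)$ for all $x\in\mathbb{R}^n$ and $r>0$. Let $\alpha>0$, and let $s_t(x,y)$, $t>0$, $x,y\in\mathbb{R}^n$, be real or complex kernels, Borel measurable in $(t,x,y)$, such that for some constant $K$ $$|s_t(x,y)|\le K\,\frac{t^{\alpha}}{t^{\alpha}\lambda(x,t)+|x-y|^{\alpha}\lambda(x,|x-y|)}$$ for all $x,y\in\mathbb{R}^n$ and $t>0$, and $$|s_t(x,y)-s_t(x,z)|\le K\,\frac{|y-z|^{\alpha}}{t^{\alpha}\lambda(x,t)+|x-y|^{\alpha}\lambda(x,|x-y|)}$$ whenever $|y-z|<t/2$ (for $x=y$ the second summand of the denominators is read as $0$). Put $$\theta_tf(x)=\int_{\mathbb{R}^n}s_t(x,y)f(y)\,d\mu(y),\qquad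 x\in\mathbb{R}^n,\ t>0.$$ For a cube $Q\subset\mathbb{R}^n$ (closed, with sides parallel to the axes) of sidelength $\ell(Q)>0$ let $\widehat Q=Q\times(0,\ell(Q))$. Suppose that there is a constant $T$ such that $$\iint_{\widehat Q}|\theta_t\chi_Q(x)|^2\,d\mu(x)\,\frac{dt}{t}\le T\,\mu(Q)\qquad\text{for every cube }Q\subset\mathbb{R}^n .$$ Then for every $f\in L^2(\mu)$ the integral defining $\theta_tf(x)$ converges absolutely for all $x\in\mathbb{R}^n$ and $t>0$, and $$\iint_{\mathbb{R}^n\times(0,\infty)}|\theta_tf(x)|^2\,d\mu(x)\,\frac{dt}{t}\le C\,\|f\|_{L^2(\mu)}^2,$$ where the constant $C$ depends only on $n$, $\alpha$, $C_\lambda$, $K$ and $T$. -/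

import Mathlib

open MeasureTheory
open scoped ENNReal NNReal

namespace SquareFunction

/-- `ℝⁿ` with the `ℓ^∞` metric: the norm and the distance on `Fin n → ℝ` are the sup ones. -/
abbrev Space (n : ℕ) : Type := Fin n → ℝ

/-- The (closed) cube with centre `c` and sidelength `ℓ`; in the `ℓ^∞` metric this is the closed
ball of radius `ℓ / 2`. -/
def cube {n : ℕ} (c : Space n) (ℓ : ℝ) : Set (Space n) := Metric.closedBall c (ℓ / 2)

/-- `μ` is an upper doubling measure with dominating function `lam` and doubling constant `Cl`.
Only the values `lam x r` with `r > 0` matter. -/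
structure IsUpperDoubling {n : ℕ} (μ : Measure (Space n)) (lam : Space n → ℝ → ℝ) (Cl : ℝ) :
    Prop where
  pos : ∀ x r, 0 < r → 0 < lam x r
  mono : ∀ x, MonotoneOn (lam x) (Set.Ioi 0)
  doubling : ∀ x r, 0 < r → lam x (2 * r) ≤ Cl * lam x r
  measure_ball_le : ∀ x r, 0 < r → μ (Metric.ball x r) ≤ ENNReal.ofReal (lam x r)

/-- The denominator `t^α lam(x,t) + |x-y|^α lam(x,|x-y|)` of the kernel estimates.
For `x = y` and `α > 0` the second summand is `0`, whatever the value `lam x 0`. -/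
noncomputable def kernelDenom {n : ℕ} (lam : Space n → ℝ → ℝ) (α t : ℝ) (x y : Space n) : ℝ :=
  t ^ α * lam x t + ‖x - y‖ ^ α * lam x ‖x - y‖

/-- The family of kernels `s t`, `t > 0`, is (jointly Borel) measurable and satisfies the size and
the smoothness estimate with exponent `α` and constant `K`.
Only the values `s t x y` with `t > 0` matter. -/
structure IsSquareKernel {n : ℕ} {𝕜 : Type*} [RCLike 𝕜] (lam : Space n → ℝ → ℝ) (α K : ℝ)
    (s : ℝ → Space n → Space n → 𝕜) : Prop where
  measurable : Measurable fun p : Set.Ioi (0 : ℝ) × Space n × Space n => s p.1 p.2.1 p.2.2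
  size : ∀ t, 0 < t → ∀ x y, ‖s t x y‖ ≤ K * (t ^ α / kernelDenom lam α t x y)
  smooth : ∀ t, 0 < t → ∀ x y z, ‖y - z‖ < t / 2 →
    ‖s t x y - s t x z‖ ≤ K * (‖y - z‖ ^ α / kernelDenom lam α t x y)

/-- `θ_t f (x) = ∫ s_t(x,y) f(y) dμ(y)`. -/
noncomputable def theta {n : ℕ} {𝕜 : Type*} [RCLike 𝕜] (μ : Measure (Space n))
    (s : ℝ → Space n → Space n → 𝕜) (t : ℝ) (f : Space n → 𝕜) (x : Space n) : 𝕜 :=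
  ∫ y, s t x y * f y ∂μ

/-- `∬_{A × I} |θ_t f(x)|² dμ(x) dt/t`, as an element of `[0, ∞]`. -/
noncomputable def squareIntegral {n : ℕ} {𝕜 : Type*} [RCLike 𝕜] (μ : Measure (Space n))
    (s : ℝ → Space n → Space n → 𝕜) (A : Set (Space n)) (I : Set ℝ) (f : Space n → 𝕜) : ℝ≥0∞ :=
  ∫⁻ t in I, (∫⁻ x in A, ‖theta μ s t f x‖ₑ ^ 2 ∂μ) * ENNReal.ofReal (1 / t)

end SquareFunction

open MeasureTheory
open scoped ENNReal NNReal

namespace SquareFunction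

/-! The proof uses random dyadic grids and good points, with a paraproduct controlled by the testing
condition.

First, the dominating function is eliminated: doubling of `lam` turns the kernel bounds into bounds
by `majorant`, a geometric superposition of averaging kernels normalised by `μ` itself. Its
marginals in both variables are bounded for any locally finite `μ`, so Schur's test replaces the
doubling of `μ`, which is not available. `IsMajorized` records what the rest needs: size, decay
`(t/R)^α` at distance `R`, and smoothness.

Fix nested grids of mesh `ℓ_i = δ 2^i` with a common shift `u`. A point is good at level `k` if it
is far from the boundaries of its cubes of all levels `k ≤ i ≤ N`. For a random shift every point is
good with probability at least `1/2`, so averaging over `u` reduces the estimate to good points, at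
the cost of a factor `2`.

For one grid and `t` comparable to `ℓ_k`, split `f` into martingale differences. Differences at
scales up to `ℓ_k` have mean zero on small cubes, and the smoothness of the kernel gains a power of
the ratio of scales. A difference at a larger scale is constant on the cube around a good point `x`,
so `θ_t` of it equals its value at `x` times `θ_t 1(x)`, up to an off-diagonal error with the same
kind of gain. These errors decay geometrically in the difference of levels, so Cauchy-Schwarz and
the orthogonality of the pieces sum them (`lintegral_levelPiece_le`, `setLIntegral_theta_sq_le`).

The main terms telescope to the paraproduct: the average of `f` over the level-`k` cube times `θ_t
1(x)`. It is bounded by `carleson_embedding`, proved with a Bellman function. The packing hypothesis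
is `carleson_packing`: on good points of a cube `Q`, `θ_t 1` is close to `θ_t` of the indicator of a
slightly smaller closed cube inside `Q`, to which testing applies. The bounds do not depend on `δ`
and `N`, so monotone convergence gives all `t > 0`. -/

set_option linter.unusedSectionVars false

/-! ### Averages over countable partitions and the Bellman inequality -/

section Averages

variable {X ι : Type*} [MeasurableSpace X] [MeasurableSpace ι] [Countable ι]
  [DiscreteMeasurableSpace ι] {𝕜 : Type*} [RCLike 𝕜] {μ : Measure X} {q : X → ι}

/-- The average of `f` over the fibre of `q` through a point. -/
noncomputable def fiberAverage (μ : Measure X) (q : X → ι) (f : X → 𝕜) (x : X) : 𝕜 :=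
  ⨍ y in q ⁻¹' {q x}, f y ∂μ

/-- The `[0, ∞]`-valued average of `f` over the fibre of `q` through a point. -/
noncomputable def fiberLAverage (μ : Measure X) (q : X → ι) (f : X → ℝ≥0∞) (x : X) : ℝ≥0∞ :=
  ⨍⁻ y in q ⁻¹' {q x}, f y ∂μ

/-- Cauchy-Schwarz for the splitting `w f = w^(1/2) · (w^(1/2) f)`. It serves both the Bellman step
and Schur's test. -/
theorem lintegral_mul_sq_le {f w : X → ℝ≥0∞} (hw : AEMeasurable w μ) (hf : AEMeasurable f μ) :
    (∫⁻ x, w x * f x ∂μ) ^ 2 ≤ (∫⁻ x, w x ∂μ) * ∫⁻ x, w x * f x ^ 2 ∂μ := by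
  have h := ENNReal.lintegral_mul_le_Lp_mul_Lq μ Real.HolderConjugate.two_two
    (f := fun x => w x ^ (1 / 2 : ℝ)) (g := fun x => w x ^ (1 / 2 : ℝ) * f x)
    (hw.pow_const _) ((hw.pow_const _).mul hf)
  have e1 : ∀ a : ℝ≥0∞, a ^ (1 / 2 : ℝ) * a ^ (1 / 2 : ℝ) = a := fun a => by
    rw [← ENNReal.rpow_add_of_nonneg _ _ (by norm_num) (by norm_num)]; norm_num
  have e2 : ∀ a : ℝ≥0∞, (a ^ (1 / 2 : ℝ)) ^ (2 : ℝ) = a := fun a => by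
    rw [← ENNReal.rpow_mul]; norm_num
  simp only [Pi.mul_apply, ← mul_assoc, e1, e2,
    ENNReal.mul_rpow_of_nonneg _ _ (zero_le_two : (0 : ℝ) ≤ 2)] at h
  have h2 := pow_le_pow_left' h 2
  rw [mul_pow] at h2
  have e3 : ∀ a : ℝ≥0∞, (a ^ (1 / 2 : ℝ)) ^ 2 = a := fun a => by
    rw [← ENNReal.rpow_natCast, ← ENNReal.rpow_mul]; norm_num
  simpa only [e3, ENNReal.rpow_two] using h2

theorem lintegral_enorm_sq_eq_ofReal {g : X → 𝕜} (hg : MemLp g 2 μ) :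
    ∫⁻ x, ‖g x‖ₑ ^ 2 ∂μ = ENNReal.ofReal (∫ x, ‖g x‖ ^ 2 ∂μ) := by
  rw [ofReal_integral_eq_lintegral_ofReal
    ((memLp_two_iff_integrable_sq_norm hg.aestronglyMeasurable).1 hg)
    (Filter.Eventually.of_forall fun x => by positivity)]
  refine lintegral_congr fun x => ?_
  rw [ENNReal.ofReal_pow (norm_nonneg _), ofReal_norm]

theorem lintegral_enorm_average_sq_add [IsFiniteMeasure μ] {g : X → 𝕜} (hg : MemLp g 2 μ) :
    ∫⁻ _, ‖⨍ y, g y ∂μ‖ₑ ^ 2 ∂μ + ∫⁻ x, ‖g x - ⨍ y, g y ∂μ‖ₑ ^ 2 ∂μ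
      = ∫⁻ x, ‖g x‖ₑ ^ 2 ∂μ := by
  set c := ⨍ y, g y ∂μ with hc
  have hcL : MemLp (fun _ : X => c) 2 μ := memLp_const c
  have hgi : Integrable g μ := hg.integrable one_le_two
  have hint : ∫ y, g y ∂μ = (μ.real Set.univ : 𝕜) * c := by
    have := measure_smul_average μ g
    rw [← this, hc, RCLike.real_smul_eq_coe_mul]
  have hsub : MemLp (fun x => g x - c) 2 μ := hg.sub hcL
  rw [lintegral_enorm_sq_eq_ofReal hcL, lintegral_enorm_sq_eq_ofReal hg,
    lintegral_enorm_sq_eq_ofReal hsub,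
    ← ENNReal.ofReal_add (by positivity) (by positivity)]
  congr 1
  have e : ∀ x, ‖g x - c‖ ^ 2 = ‖g x‖ ^ 2 + ‖c‖ ^ 2 - 2 * RCLike.re (g x * (starRingEnd 𝕜) c) := by
    intro x
    simpa only [RCLike.normSq_eq_def'] using RCLike.normSq_sub (g x) c
  have i1 : Integrable (fun x => ‖g x‖ ^ 2) μ :=
    (memLp_two_iff_integrable_sq_norm hg.aestronglyMeasurable).1 hg
  have i2 : Integrable (fun x => g x * (starRingEnd 𝕜) c) μ := hgi.mul_const _
  have i3 : Integrable (fun x => RCLike.re (g x * (starRingEnd 𝕜) c)) μ := i2.re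
  simp_rw [e]
  have i4 : Integrable (fun x => ‖g x‖ ^ 2 + ‖c‖ ^ 2) μ := i1.add (integrable_const _)
  rw [integral_sub i4 (i3.const_mul 2),
    integral_add i1 (integrable_const _), integral_const_mul, integral_re i2,
    integral_mul_const, hint, mul_assoc, RCLike.mul_conj]
  simp only [integral_const, smul_eq_mul]
  norm_cast
  ring

theorem lintegral_eq_tsum_fiber (hq : Measurable q) (f : X → ℝ≥0∞) :
    ∫⁻ x, f x ∂μ = ∑' i, ∫⁻ x in q ⁻¹' {i}, f x ∂μ := by
  rw [← lintegral_iUnion (fun i => hq (measurableSet_singleton i)), ← Set.preimage_iUnion,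
    Set.iUnion_of_singleton, Set.preimage_univ, Measure.restrict_univ]
  intro i j hij
  exact Disjoint.preimage q (by simpa using hij)

theorem measurable_fiberAverage (hq : Measurable q) (f : X → 𝕜) :
    Measurable (fiberAverage μ q f) :=
  (measurable_of_countable (fun i => ⨍ y in q ⁻¹' {i}, f y ∂μ)).comp hq

theorem measurable_fiberLAverage (hq : Measurable q) (f : X → ℝ≥0∞) :
    Measurable (fiberLAverage μ q f) :=
  (measurable_of_countable (fun i => ⨍⁻ y in q ⁻¹' {i}, f y ∂μ)).comp hq

theorem fiberAverage_congr {f : X → 𝕜} {x y : X} (h : q x = q y) :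
    fiberAverage μ q f x = fiberAverage μ q f y := by
  simp only [fiberAverage, h]

/-- Pythagoras for the orthogonal projection onto functions that are constant on fibres. -/
theorem lintegral_fiberAverage_sq_add (hq : Measurable q) (hfin : ∀ i, μ (q ⁻¹' {i}) < ∞)
    {g : X → 𝕜} (hg : MemLp g 2 μ) :
    ∫⁻ x, ‖fiberAverage μ q g x‖ₑ ^ 2 ∂μ + ∫⁻ x, ‖g x - fiberAverage μ q g x‖ₑ ^ 2 ∂μ
      = ∫⁻ x, ‖g x‖ₑ ^ 2 ∂μ := by
  simp only [lintegral_eq_tsum_fiber (μ := μ) hq]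
  rw [← ENNReal.tsum_add]
  congr 1 with i
  have : IsFiniteMeasure (μ.restrict (q ⁻¹' {i})) := ⟨by simpa using hfin i⟩
  rw [← lintegral_enorm_average_sq_add (hg.restrict (q ⁻¹' {i}))]
  congr 1
  · refine setLIntegral_congr_fun (hq (measurableSet_singleton i)) fun x hx => ?_
    simp only [Set.mem_preimage, Set.mem_singleton_iff] at hx
    simp only [fiberAverage, hx]
  · refine setLIntegral_congr_fun (hq (measurableSet_singleton i)) fun x hx => ?_
    simp only [Set.mem_preimage, Set.mem_singleton_iff] at hx
    simp only [fiberAverage, hx]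

theorem memLp_two_of_lintegral {g : X → 𝕜} (hm : AEStronglyMeasurable g μ)
    (h : ∫⁻ x, ‖g x‖ₑ ^ 2 ∂μ < ∞) : MemLp g 2 μ := by
  refine ⟨hm, ?_⟩
  rw [eLpNorm_lt_top_iff_lintegral_rpow_enorm_lt_top two_ne_zero ENNReal.ofNat_ne_top]
  simpa using h

theorem eLpNorm_two_sq (g : X → 𝕜) : eLpNorm g 2 μ ^ 2 = ∫⁻ x, ‖g x‖ₑ ^ 2 ∂μ := by
  rw [eLpNorm_eq_lintegral_rpow_enorm_toReal two_ne_zero ENNReal.ofNat_ne_top,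
    ← ENNReal.rpow_natCast, ← ENNReal.rpow_mul]
  simp

theorem lintegral_sq_lt_top {g : X → 𝕜} (hg : MemLp g 2 μ) : ∫⁻ x, ‖g x‖ₑ ^ 2 ∂μ < ∞ := by
  rw [← eLpNorm_two_sq]
  exact ENNReal.pow_lt_top hg.eLpNorm_lt_top

theorem memLp_fiberAverage (hq : Measurable q) (hfin : ∀ i, μ (q ⁻¹' {i}) < ∞)
    {g : X → 𝕜} (hg : MemLp g 2 μ) : MemLp (fiberAverage μ q g) 2 μ := by
  refine memLp_two_of_lintegral (measurable_fiberAverage hq g).aestronglyMeasurable ?_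
  refine lt_of_le_of_lt ?_ (lintegral_sq_lt_top hg)
  rw [← lintegral_fiberAverage_sq_add hq hfin hg]
  exact le_self_add

theorem enorm_average_le_laverage (g : X → 𝕜) : ‖⨍ y, g y ∂μ‖ₑ ≤ ⨍⁻ y, ‖g y‖ₑ ∂μ :=
  enorm_integral_le_lintegral_enorm _

theorem enorm_fiberAverage_le {g : X → 𝕜} {F : X → ℝ≥0∞} (h : ∀ x, ‖g x‖ₑ ≤ F x) (x : X) :
    ‖fiberAverage μ q g x‖ₑ ≤ fiberLAverage μ q F x :=
  (enorm_average_le_laverage g).trans (lintegral_mono h)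

theorem integral_fiber_sub_fiberAverage (hq : Measurable q) (hfin : ∀ i, μ (q ⁻¹' {i}) < ∞)
    {g : X → 𝕜} (hg : MemLp g 2 μ) (i : ι) :
    ∫ x in q ⁻¹' {i}, (g x - fiberAverage μ q g x) ∂μ = 0 := by
  have : IsFiniteMeasure (μ.restrict (q ⁻¹' {i})) := ⟨by simpa using hfin i⟩
  have hgi : IntegrableOn g (q ⁻¹' {i}) μ := (hg.restrict _).integrable one_le_two
  rw [setIntegral_congr_fun (g := fun x => g x - ⨍ y in q ⁻¹' {i}, g y ∂μ)
    (hq (measurableSet_singleton i))]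
  · exact integral_sub_average _ _
  · intro x hx
    simp only [Set.mem_preimage, Set.mem_singleton_iff] at hx
    simp only [fiberAverage, hx]

/-- Functions of mean zero on all fibres are orthogonal to functions constant on fibres. -/
theorem integral_comp_mul_eq_zero (hq : Measurable q) {g : X → 𝕜} {φ : ι → 𝕜}
    (hg : ∀ i, ∫ x in q ⁻¹' {i}, g x ∂μ = 0) (hi : Integrable (fun x => φ (q x) * g x) μ) :
    ∫ x, φ (q x) * g x ∂μ = 0 := by
  have hU : (⋃ i, q ⁻¹' {i}) = Set.univ := by
    rw [← Set.preimage_iUnion, Set.iUnion_of_singleton, Set.preimage_univ]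
  rw [← setIntegral_univ, ← hU, integral_iUnion (fun i => hq (measurableSet_singleton i))
    (fun i j hij => Disjoint.preimage q (by simpa using hij)) hi.integrableOn]
  refine (tsum_congr fun i => ?_).trans tsum_zero
  rw [setIntegral_congr_fun (g := fun x => φ i * g x) (hq (measurableSet_singleton i)),
    integral_const_mul, hg, mul_zero]
  intro x hx
  simp only [Set.mem_preimage, Set.mem_singleton_iff] at hx
  simp only [hx]

theorem setLIntegral_fiberLAverage (hq : Measurable q) (hfin : ∀ i, μ (q ⁻¹' {i}) < ∞)
    (g : X → ℝ≥0∞) (i : ι) :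
    ∫⁻ x in q ⁻¹' {i}, fiberLAverage μ q g x ∂μ = ∫⁻ x in q ⁻¹' {i}, g x ∂μ := by
  have : IsFiniteMeasure (μ.restrict (q ⁻¹' {i})) := ⟨by simpa using hfin i⟩
  rw [← lintegral_laverage (μ.restrict (q ⁻¹' {i})) g]
  refine setLIntegral_congr_fun (hq (measurableSet_singleton i)) fun x hx => ?_
  simp only [Set.mem_preimage, Set.mem_singleton_iff] at hx
  simp only [fiberLAverage, hx]

/-- Averaging over a finer partition does not change averages over a coarser one. -/
theorem fiberLAverage_fiberLAverage {κ : Type*} [MeasurableSpace κ]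
    [DiscreteMeasurableSpace κ] {p : X → κ} (hq : Measurable q)
    (hfin : ∀ i, μ (q ⁻¹' {i}) < ∞) {r : ι → κ} (hr : ∀ x, p x = r (q x)) (g : X → ℝ≥0∞) (x : X) :
    fiberLAverage μ p (fiberLAverage μ q g) x = fiberLAverage μ p g x := by
  classical
  suffices h : ∫⁻ y in p ⁻¹' {p x}, fiberLAverage μ q g y ∂μ = ∫⁻ y in p ⁻¹' {p x}, g y ∂μ by
    rw [fiberLAverage, fiberLAverage, setLAverage_eq, setLAverage_eq, h]
  have hp : Measurable p := by
    have : p = r ∘ q := funext hr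
    rw [this]; exact (measurable_of_countable r).comp hq
  have hA : MeasurableSet (p ⁻¹' {p x}) := hp (measurableSet_singleton _)
  have key : ∀ f : X → ℝ≥0∞, ∫⁻ y in p ⁻¹' {p x}, f y ∂μ =
      ∑' i, if r i = p x then ∫⁻ y in q ⁻¹' {i}, f y ∂μ else 0 := by
    intro f
    rw [← lintegral_indicator hA, lintegral_eq_tsum_fiber hq]
    refine tsum_congr fun i => ?_
    split_ifs with hi
    · refine setLIntegral_congr_fun (hq (measurableSet_singleton i)) fun y hy => ?_
      simp only [Set.mem_preimage, Set.mem_singleton_iff] at hy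
      rw [Set.indicator_of_mem]
      simp [hr y, hy, hi]
    · rw [setLIntegral_congr_fun (g := fun _ => 0) (hq (measurableSet_singleton i)), lintegral_zero]
      intro y hy
      simp only [Set.mem_preimage, Set.mem_singleton_iff] at hy
      refine Set.indicator_of_notMem ?_ _
      simp [hr y, hy, hi]
  rw [key g]
  simp only [← setLIntegral_fiberLAverage hq hfin g]
  exact key _

/-- One fibre of the Bellman argument: `V` is its measure and `G`, `a`, `b` are the integrals of the
function, of the weight accumulated so far and of the new weight. By `hCS` the claim reduces to `b /
V² ≤ 4 / (V + a) - 4 / (V + a + b)`. The right side is `4 b / ((V + a) (V + a + b))`, and both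
factors are at most `2 V` because `a + b ≤ V`. This is the origin of the `4`. -/
theorem bellman_inequality {G V I a b : ℝ≥0∞} (h0 : V ≠ 0) (hft : V ≠ ∞)
    (hCS : G ^ 2 ≤ (V + a) * I) (hab : a + b ≤ V) :
    b * (G / V) ^ 2 + 4 * ((G / V) ^ 2 * (1 + (a + b) / V)⁻¹ * V) ≤ 4 * I := by
  by_cases hI : I = ∞
  · simp [hI]
  have hat : a ≠ ∞ := (lt_of_le_of_lt (le_self_add.trans hab) hft.lt_top).ne
  have hbt : b ≠ ∞ := (lt_of_le_of_lt (le_add_self.trans hab) hft.lt_top).ne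
  have hGt : G ≠ ∞ := by
    intro h
    rw [h] at hCS
    refine absurd hCS (not_le.2 ?_)
    simpa using ENNReal.mul_lt_top (ENNReal.add_lt_top.2 ⟨hft.lt_top, hat.lt_top⟩)
      (lt_top_iff_ne_top.2 hI)
  lift G to ℝ≥0 using hGt
  lift V to ℝ≥0 using hft
  lift I to ℝ≥0 using hI
  lift a to ℝ≥0 using hat
  lift b to ℝ≥0 using hbt
  have hV : V ≠ 0 := by simpa using h0
  have hV0 : 0 < V := pos_iff_ne_zero.2 hV
  have h1 : (1 + (a + b) / V : ℝ≥0∞)⁻¹ = ((V / (V + (a + b)) : ℝ≥0) : ℝ≥0∞) := by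
    have : (1 + (a + b) / V : ℝ≥0∞) = (((V + (a + b)) / V : ℝ≥0) : ℝ≥0∞) := by
      rw [ENNReal.coe_div hV, ← ENNReal.coe_add, ENNReal.coe_add V, ENNReal.add_div,
        ENNReal.div_self (by simpa using hV) ENNReal.coe_ne_top]
    rw [this, ← ENNReal.coe_inv (by positivity), inv_div]
  rw [h1, ← ENNReal.coe_div hV]
  norm_cast at hCS hab ⊢
  rw [← NNReal.coe_le_coe] at hCS hab ⊢
  push_cast at hCS hab ⊢
  have hVr : (0 : ℝ) < V := hV0
  have ha0 : (0 : ℝ) ≤ a := a.2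
  have hb0 : (0 : ℝ) ≤ b := b.2
  have hG : (G : ℝ) ^ 2 / (V + a) ≤ I := by
    rw [div_le_iff₀ (by positivity)]; linarith
  refine le_trans ?_ (mul_le_mul_of_nonneg_left hG (by norm_num : (0 : ℝ) ≤ 4))
  have key : (b : ℝ) / V ^ 2 + 4 / (V + (a + b)) ≤ 4 / (V + a) := by
    rw [div_add_div _ _ (by positivity) (by positivity), div_le_div_iff₀ (by positivity)
      (by positivity)]
    have h4 : (V + (a + b) : ℝ) * (V + a) ≤ 4 * V ^ 2 := by nlinarith
    nlinarith [mul_le_mul_of_nonneg_left h4 hb0]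
  have := mul_le_mul_of_nonneg_left key (sq_nonneg (G : ℝ))
  calc (b : ℝ) * (G / V) ^ 2 + 4 * ((G / V) ^ 2 * (V / (V + (a + b))) * V)
      = G ^ 2 * (b / V ^ 2 + 4 / (V + (a + b))) := by field_simp
    _ ≤ _ := this
    _ = _ := by ring

/-- The Bellman function inequality behind the dyadic Carleson embedding theorem. -/
theorem lintegral_mul_sq_fiberLAverage_add_le (hq : Measurable q) (hfin : ∀ i, μ (q ⁻¹' {i}) < ∞)
    {g w M : X → ℝ≥0∞} (hg : AEMeasurable g μ) (hw : Measurable w) (hM : Measurable M)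
    (hM1 : ∀ x, M x ≤ 1) (hMw : ∀ x, fiberLAverage μ q (fun y => M y + w y) x ≤ 1) :
    ∫⁻ x, w x * fiberLAverage μ q g x ^ 2 ∂μ + 4 * ∫⁻ x, fiberLAverage μ q g x ^ 2 *
      (1 + fiberLAverage μ q (fun y => M y + w y) x)⁻¹ ∂μ ≤ 4 * ∫⁻ x, g x ^ 2 * (1 + M x)⁻¹ ∂μ := by
  simp only [lintegral_eq_tsum_fiber (μ := μ) hq, ← ENNReal.tsum_mul_left]
  rw [← ENNReal.tsum_add]
  refine ENNReal.tsum_le_tsum fun i => ?_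
  have hS := hq (measurableSet_singleton i)
  by_cases h0 : μ (q ⁻¹' {i}) = 0
  · simp [Measure.restrict_eq_zero.2 h0]
  obtain ⟨x, hx⟩ : ∃ x, q x = i := by
    by_contra! h
    exact h0 (by rw [Set.preimage_singleton_eq_empty.2 (by rintro ⟨x, hx⟩; exact h x hx)]; simp)
  have hm := hMw x
  have hft := (hfin i).ne
  simp only [fiberLAverage, setLAverage_eq, hx] at hm
  set A := q ⁻¹' {i}
  set G := ∫⁻ y in A, g y ∂μ
  set m := (∫⁻ y in A, M y + w y ∂μ) / μ A with hmdef
  set V := μ A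
  have cF : ∀ y ∈ A, fiberLAverage μ q g y = G / V := by
    intro y hy
    have : q y = i := hy
    simp only [fiberLAverage, setLAverage_eq, this, A, G, V]
  have cm : ∀ y ∈ A, fiberLAverage μ q (fun y => M y + w y) y = m := by
    intro y hy
    have : q y = i := hy
    simp only [fiberLAverage, setLAverage_eq, this, hmdef, A, V]
  rw [setLIntegral_congr_fun (f := fun y => w y * fiberLAverage μ q g y ^ 2)
      (g := fun y => w y * (G / V) ^ 2) hS (fun y hy => by simp only [cF y hy]),
    setLIntegral_congr_fun (f := fun y => fiberLAverage μ q g y ^ 2 *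
        (1 + fiberLAverage μ q (fun z => M z + w z) y)⁻¹)
      (g := fun y => (G / V) ^ 2 * (1 + m)⁻¹) hS
      (fun y hy => by simp only [cF y hy, cm y hy]), lintegral_mul_const _ hw,
    setLIntegral_const]
  -- Cauchy-Schwarz on the fibre
  have hCS : G ^ 2 ≤ (V + ∫⁻ y in A, M y ∂μ) * ∫⁻ y in A, g y ^ 2 * (1 + M y)⁻¹ ∂μ := by
    have h := lintegral_mul_sq_le (μ := μ.restrict A) (w := fun y => 1 + M y)
      (f := fun y => g y * (1 + M y)⁻¹) (by fun_prop)
      (hg.restrict.mul (measurable_const.add hM).inv.aemeasurable)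
    have hne : ∀ y, 1 + M y ≠ 0 := fun y => by simp
    have hnt : ∀ y, 1 + M y ≠ ∞ := fun y =>
      ENNReal.add_ne_top.2 ⟨ENNReal.one_ne_top, ((hM1 y).trans_lt ENNReal.one_lt_top).ne⟩
    have e1 : ∀ y, (1 + M y) * (g y * (1 + M y)⁻¹) = g y := fun y => by
      rw [mul_comm, mul_assoc, ENNReal.inv_mul_cancel (hne y) (hnt y), mul_one]
    have e2 : ∀ y, (1 + M y) * (g y * (1 + M y)⁻¹) ^ 2 = g y ^ 2 * (1 + M y)⁻¹ := fun y => by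
      rw [sq, ← mul_assoc, e1]; ring
    simp only [e1, e2] at h
    rwa [lintegral_add_left measurable_const, setLIntegral_const, one_mul] at h
  set I := ∫⁻ y in A, g y ^ 2 * (1 + M y)⁻¹ ∂μ
  have hsum : ∫⁻ y in A, M y + w y ∂μ = (∫⁻ y in A, M y ∂μ) + ∫⁻ y in A, w y ∂μ :=
    lintegral_add_left hM _
  set a := ∫⁻ y in A, M y ∂μ
  set b := ∫⁻ y in A, w y ∂μ
  rw [hsum] at hmdef
  have hab : a + b ≤ V := by
    rw [hmdef] at hm
    have := (ENNReal.div_le_iff h0 hft).1 hm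
    simpa using this
  rw [hmdef]
  exact bellman_inequality h0 hft hCS hab

end Averages

/-! ### Schur's test -/

section SchurTest

variable {X Y : Type*} [MeasurableSpace X] [MeasurableSpace Y] {μ : Measure X} {ν : Measure Y}
  [SFinite μ] [SFinite ν]

theorem sq_lintegral_kernel_le {k : X → Y → ℝ≥0∞} (hk : Measurable (Function.uncurry k))
    {A : ℝ≥0∞} (hy : ∀ x, ∫⁻ y, k x y ∂ν ≤ A) (hx : ∀ y, ∫⁻ x, k x y ∂μ ≤ A)
    {g : Y → ℝ≥0∞} (hg : Measurable g) :
    ∫⁻ x, (∫⁻ y, k x y * g y ∂ν) ^ 2 ∂μ ≤ A ^ 2 * ∫⁻ y, g y ^ 2 ∂ν := by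
  have hm : Measurable (Function.uncurry fun x y => k x y * g y ^ 2) :=
    hk.mul ((hg.comp measurable_snd).pow_const 2)
  calc ∫⁻ x, (∫⁻ y, k x y * g y ∂ν) ^ 2 ∂μ
      ≤ ∫⁻ x, A * ∫⁻ y, k x y * g y ^ 2 ∂ν ∂μ := by
        refine lintegral_mono fun x => ?_
        refine (lintegral_mul_sq_le (hk.of_uncurry_left).aemeasurable hg.aemeasurable).trans ?_
        gcongr
        exact hy x
    _ = A * ∫⁻ y, (∫⁻ x, k x y ∂μ) * g y ^ 2 ∂ν := by
        rw [lintegral_const_mul _ hm.lintegral_prod_right, lintegral_lintegral_swap hm.aemeasurable]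
        congr 1
        refine lintegral_congr fun y => ?_
        rw [lintegral_mul_const _ hk.of_uncurry_right]
    _ ≤ A * ∫⁻ y, A * g y ^ 2 ∂ν := by
        gcongr with y
        exact hx y
    _ = _ := by
        rw [lintegral_const_mul _ (hg.pow_const 2)]; ring

end SchurTest

/-! ### Averaging kernels with bounded marginals -/

section Majorant

variable {n : ℕ} {μ : Measure (Space n)}

/-- A superposition of averaging kernels over balls of radii `2 ^ m * R`, which dominates the
square function kernels. -/
noncomputable def majorant (μ : Measure (Space n)) (α R : ℝ) (x y : Space n) : ℝ≥0∞ :=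
  ∑' m : ℕ, ENNReal.ofReal (2 ^ (-α)) ^ m *
    (if dist x y < 2 ^ m * R then (μ (Metric.ball x (2 * (2 ^ m * R))))⁻¹ else 0)

/-- The bound for the marginals of the majorant. -/
noncomputable def majorantBound (α : ℝ) : ℝ≥0∞ := (1 - ENNReal.ofReal (2 ^ (-α)))⁻¹

theorem majorantBound_lt_top {α : ℝ} (hα : 0 < α) : majorantBound α < ∞ := by
  rw [majorantBound, ENNReal.inv_lt_top, tsub_pos_iff_lt]
  rw [ENNReal.ofReal_lt_one]
  exact Real.rpow_lt_one_of_one_lt_of_neg one_lt_two (by linarith)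

theorem measurable_measure_ball [SFinite μ] (r : ℝ) :
    Measurable fun x => μ (Metric.ball x r) := by
  have h : MeasurableSet {p : Space n × Space n | dist p.2 p.1 < r} :=
    measurableSet_lt (by fun_prop) measurable_const
  exact measurable_measure_prodMk_left h

theorem measurable_averagingKernel [SFinite μ] (r : ℝ) :
    Measurable fun p : Space n × Space n =>
      if dist p.1 p.2 < r then (μ (Metric.ball p.1 (2 * r)))⁻¹ else 0 := by
  refine Measurable.ite (measurableSet_lt (by fun_prop) measurable_const) ?_ measurable_const
  exact ((measurable_measure_ball (2 * r)).comp measurable_fst).inv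

theorem measurable_majorant [SFinite μ] (α R : ℝ) :
    Measurable (Function.uncurry (majorant μ α R)) :=
  Measurable.tsum fun m => (measurable_averagingKernel (2 ^ m * R)).const_mul _

theorem lintegral_averagingKernel_right_le (r : ℝ) (x : Space n) :
    ∫⁻ y, (if dist x y < r then (μ (Metric.ball x (2 * r)))⁻¹ else 0) ∂μ ≤ 1 := by
  have : (fun y => if dist x y < r then (μ (Metric.ball x (2 * r)))⁻¹ else 0) =
      (Metric.ball x r).indicator fun _ => (μ (Metric.ball x (2 * r)))⁻¹ := by
    ext y
    simp [Set.indicator, dist_comm]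
  rw [this, lintegral_indicator Metric.isOpen_ball.measurableSet, setLIntegral_const]
  by_cases hr : 0 < r
  · refine le_trans ?_ (ENNReal.inv_mul_le_one (μ (Metric.ball x (2 * r))))
    gcongr
    linarith
  · rw [Metric.ball_eq_empty.2 (not_lt.1 hr)]; simp

/-- The reason for the doubled radius in the normalisation: if `dist x y < r` then `B(y, r) ⊆ B(x,
2r)`, so the weight, which depends on `x`, is at most `1 / μ(B(y, r))`. No doubling of `μ` enters.
-/
theorem lintegral_averagingKernel_left_le (r : ℝ) (y : Space n) :
    ∫⁻ x, (if dist x y < r then (μ (Metric.ball x (2 * r)))⁻¹ else 0) ∂μ ≤ 1 := by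
  calc _ ≤ ∫⁻ x, (Metric.ball y r).indicator (fun _ => (μ (Metric.ball y r))⁻¹) x ∂μ := by
        refine lintegral_mono fun x => ?_
        simp only [Set.indicator, Metric.mem_ball]
        split_ifs with h
        · refine ENNReal.inv_le_inv.2 (measure_mono ?_)
          refine Metric.ball_subset_ball' ?_
          rw [dist_comm] at h
          linarith
        · exact le_rfl
    _ ≤ 1 := by
        rw [lintegral_indicator Metric.isOpen_ball.measurableSet, setLIntegral_const]
        exact ENNReal.inv_mul_le_one _

theorem lintegral_majorant_right_le [SFinite μ] (α R : ℝ) (x : Space n) :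
    ∫⁻ y, majorant μ α R x y ∂μ ≤ majorantBound α := by
  have hm : ∀ m : ℕ, Measurable fun y : Space n =>
      if dist x y < 2 ^ m * R then (μ (Metric.ball x (2 * (2 ^ m * R))))⁻¹ else 0 := fun m =>
    (measurable_averagingKernel (μ := μ) (2 ^ m * R)).comp measurable_prodMk_left
  simp only [majorant]
  rw [lintegral_tsum fun m => ((hm m).const_mul _).aemeasurable, majorantBound,
    ← ENNReal.tsum_geometric]
  refine ENNReal.tsum_le_tsum fun m => ?_
  rw [lintegral_const_mul _ (hm m)]
  exact mul_le_of_le_one_right' (lintegral_averagingKernel_right_le _ x)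

theorem lintegral_majorant_left_le [SFinite μ] (α R : ℝ) (y : Space n) :
    ∫⁻ x, majorant μ α R x y ∂μ ≤ majorantBound α := by
  have hm : ∀ m : ℕ, Measurable fun x : Space n =>
      if dist x y < 2 ^ m * R then (μ (Metric.ball x (2 * (2 ^ m * R))))⁻¹ else 0 := fun m =>
    (measurable_averagingKernel (μ := μ) (2 ^ m * R)).comp measurable_prodMk_right
  simp only [majorant]
  rw [lintegral_tsum fun m => ((hm m).const_mul _).aemeasurable, majorantBound,
    ← ENNReal.tsum_geometric]
  refine ENNReal.tsum_le_tsum fun m => ?_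
  rw [lintegral_const_mul _ (hm m)]
  exact mul_le_of_le_one_right' (lintegral_averagingKernel_left_le _ y)

/-- The majorants are bounded on `L²`. -/
theorem sq_lintegral_majorant_le [SFinite μ] (α R : ℝ) {g : Space n → ℝ≥0∞} (hg : Measurable g) :
    ∫⁻ x, (∫⁻ y, majorant μ α R x y * g y ∂μ) ^ 2 ∂μ ≤
      majorantBound α ^ 2 * ∫⁻ y, g y ^ 2 ∂μ :=
  sq_lintegral_kernel_le (measurable_majorant α R) (lintegral_majorant_right_le α R)
    (lintegral_majorant_left_le α R) hg

theorem le_majorant (α R : ℝ) {x y : Space n} (m : ℕ) (h : dist x y < 2 ^ m * R) :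
    ENNReal.ofReal (2 ^ (-α)) ^ m * (μ (Metric.ball x (2 * (2 ^ m * R))))⁻¹ ≤
      majorant μ α R x y := by
  refine le_trans ?_ (ENNReal.le_tsum m)
  rw [if_pos h]

end Majorant

/-! ### From the dominating function to the majorants -/

section Majorized

variable {n : ℕ} {μ : Measure (Space n)} {𝕜 : Type*} [RCLike 𝕜]

/-- Kernel estimates in terms of the majorants, without a dominating function. -/
structure IsMajorized (μ : Measure (Space n)) (α : ℝ) (C : ℝ≥0)
    (s : ℝ → Space n → Space n → 𝕜) : Prop where
  measurable : Measurable fun p : ℝ × Space n × Space n => s p.1 p.2.1 p.2.2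
  bounded : ∀ t, 0 < t → ∀ x, ∃ B : ℝ, ∀ y, ‖s t x y‖ ≤ B
  size : ∀ t, 0 < t → ∀ x y, ‖s t x y‖ₑ ≤ C * majorant μ α t x y
  far : ∀ t, 0 < t → ∀ R, 0 < R → ∀ x y, R ≤ dist x y →
    ‖s t x y‖ₑ ≤ C * ENNReal.ofReal ((t / R) ^ α) * majorant μ α R x y
  smooth : ∀ t, 0 < t → ∀ x y z, dist y z < t / 2 →
    ‖s t x y - s t x z‖ₑ ≤ C * ENNReal.ofReal ((dist y z / t) ^ α) * majorant μ α t x y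

section Domination

variable {lam : Space n → ℝ → ℝ} {α Cl K : ℝ}

theorem IsUpperDoubling.one_le (h : IsUpperDoubling μ lam Cl) : 1 ≤ Cl := by
  have h1 := h.pos 0 1 one_pos
  have h2 : lam 0 1 ≤ lam 0 (2 * 1) := h.mono 0 (by simp) (by simp) (by norm_num)
  have h3 := h.doubling 0 1 one_pos
  by_contra! hc
  nlinarith

theorem IsUpperDoubling.ofReal_inv_le (h : IsUpperDoubling μ lam Cl) (x : Space n) {r : ℝ}
    (hr : 0 < r) : ENNReal.ofReal (lam x r)⁻¹ ≤ (μ (Metric.ball x r))⁻¹ := by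
  rw [ENNReal.ofReal_inv_of_pos (h.pos x r hr)]
  exact ENNReal.inv_le_inv.2 (h.measure_ball_le x r hr)

theorem IsUpperDoubling.inv_le (h : IsUpperDoubling μ lam Cl) (x : Space n) {r : ℝ}
    (hr : 0 < r) : (lam x r)⁻¹ ≤ Cl * (lam x (2 * r))⁻¹ := by
  have h1 := h.pos x r hr
  have h2 := h.pos x (2 * r) (by positivity)
  rw [← div_eq_mul_inv, inv_eq_one_div, div_le_div_iff₀ h1 h2, one_mul]
  exact h.doubling x r hr

theorem IsUpperDoubling.kernelDenom_ge_left (h : IsUpperDoubling μ lam Cl) (hα : 0 < α) (t : ℝ)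
    (x y : Space n) : t ^ α * lam x t ≤ kernelDenom lam α t x y := by
  rw [kernelDenom]
  rcases (norm_nonneg (x - y)).eq_or_lt with h0 | h0
  · rw [← h0, Real.zero_rpow hα.ne', zero_mul, add_zero]
  · have := h.pos x _ h0
    have : 0 ≤ ‖x - y‖ ^ α * lam x ‖x - y‖ := by positivity
    linarith

theorem IsUpperDoubling.kernelDenom_ge_right (h : IsUpperDoubling μ lam Cl) {t : ℝ} (ht : 0 < t)
    (x y : Space n) : ‖x - y‖ ^ α * lam x ‖x - y‖ ≤ kernelDenom lam α t x y := by
  rw [kernelDenom]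
  have := h.pos x _ ht
  have : 0 ≤ t ^ α * lam x t := by positivity
  linarith

theorem IsUpperDoubling.div_kernelDenom_le (h : IsUpperDoubling μ lam Cl) (hα : 0 < α) {t : ℝ}
    (ht : 0 < t) (x y : Space n) : t ^ α / kernelDenom lam α t x y ≤ (lam x t)⁻¹ := by
  have h1 := h.pos x t ht
  have h2 : 0 < t ^ α := by positivity
  calc t ^ α / kernelDenom lam α t x y ≤ t ^ α / (t ^ α * lam x t) :=
        div_le_div_of_nonneg_left h2.le (by positivity) (h.kernelDenom_ge_left hα t x y)
    _ = _ := by field_simp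

/-- The constant in the domination of the size bound by the majorants. -/
noncomputable def dominationConst (α Cl : ℝ) : ℝ := 2 ^ α * Cl ^ 2 + Cl

/-- A single term of the majorant suffices: the one whose radius is the dyadic multiple of `R` just
above `dist x y`. The power of the distance in the denominator supplies both `(t/R)^α` and the
geometric factor of that term. -/
theorem IsUpperDoubling.far_le (h : IsUpperDoubling μ lam Cl) (hα : 0 < α) {t R : ℝ}
    (ht : 0 < t) (hR : 0 < R) {x y : Space n} (hxy : R ≤ dist x y) :
    ENNReal.ofReal (t ^ α / kernelDenom lam α t x y) ≤
      ENNReal.ofReal (dominationConst α Cl) * ENNReal.ofReal ((t / R) ^ α) *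
        majorant μ α R x y := by
  have hCl := h.one_le
  set d := dist x y with hd
  have hdn : ‖x - y‖ = d := (dist_eq_norm x y).symm
  have hd0 : 0 < d := hR.trans_le hxy
  obtain ⟨m, hm1, hm2⟩ := exists_nat_pow_near (x := d / R) ((one_le_div hR).2 hxy) one_lt_two
  rw [le_div_iff₀ hR] at hm1
  rw [div_lt_iff₀ hR] at hm2
  -- This is the radius of the normalising ball in the term `m + 1`. It is at most `4 d`, so two
  -- doublings compare `lam x ρ` with `lam x d`; hence `Cl ^ 2`.
  set ρ := 2 * (2 ^ (m + 1) * R) with hρ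
  have hρ0 : 0 < ρ := by positivity
  have l1 : lam x ρ ≤ Cl ^ 2 * lam x d := by
    have a1 : lam x ρ ≤ lam x (2 * (2 * d)) := by
      refine h.mono x hρ0 (by simpa using hd0) ?_
      rw [hρ, pow_succ]; linarith
    have a2 := h.doubling x (2 * d) (by positivity)
    have a3 := h.doubling x d hd0
    nlinarith
  have l2 := h.pos x d hd0
  have l3 := h.pos x ρ hρ0
  have key : t ^ α / kernelDenom lam α t x y ≤
      dominationConst α Cl * (t / R) ^ α * ((2 ^ (-α)) ^ (m + 1) * (lam x ρ)⁻¹) := by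
    have hden := h.kernelDenom_ge_right (α := α) ht x y
    rw [hdn] at hden
    have p1 : (2 ^ m * R) ^ α ≤ d ^ α := Real.rpow_le_rpow (by positivity) hm1 hα.le
    have p2 : (0 : ℝ) < (2 ^ m * R) ^ α := by positivity
    have p3 : (lam x d)⁻¹ ≤ Cl ^ 2 * (lam x ρ)⁻¹ := by
      rw [← div_eq_mul_inv, inv_eq_one_div, div_le_div_iff₀ l2 l3, one_mul]; exact l1
    calc t ^ α / kernelDenom lam α t x y ≤ t ^ α / ((2 ^ m * R) ^ α * lam x d) := by
          refine div_le_div_of_nonneg_left (by positivity) (by positivity) (le_trans ?_ hden)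
          gcongr
      _ = t ^ α / (2 ^ m * R) ^ α * (lam x d)⁻¹ := by field_simp
      _ ≤ t ^ α / (2 ^ m * R) ^ α * (Cl ^ 2 * (lam x ρ)⁻¹) := by gcongr
      _ = 2 ^ α * Cl ^ 2 * (t / R) ^ α * ((2 ^ (-α)) ^ (m + 1) * (lam x ρ)⁻¹) := by
          rw [Real.mul_rpow (by positivity) hR.le, Real.div_rpow ht.le hR.le,
            Real.rpow_neg zero_le_two, ← Real.rpow_natCast 2 m, ← Real.rpow_mul zero_le_two,
            mul_comm (m : ℝ) α, Real.rpow_mul zero_le_two, Real.rpow_natCast]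
          have : (0 : ℝ) < 2 ^ α := by positivity
          field_simp
          rw [one_div, inv_pow, pow_succ]
          field_simp
      _ ≤ _ := by
          gcongr
          rw [dominationConst]; linarith
  refine (ENNReal.ofReal_le_ofReal key).trans ?_
  have hK0 : 0 ≤ dominationConst α Cl := by rw [dominationConst]; positivity
  rw [ENNReal.ofReal_mul (by positivity), ENNReal.ofReal_mul hK0,
    ENNReal.ofReal_mul (by positivity), ENNReal.ofReal_pow (by positivity)]
  gcongr
  refine le_trans ?_ (le_majorant α R (m + 1) hm2)
  gcongr
  exact h.ofReal_inv_le x hρ0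

theorem IsUpperDoubling.size_le (h : IsUpperDoubling μ lam Cl) (hα : 0 < α) {t : ℝ}
    (ht : 0 < t) (x y : Space n) :
    ENNReal.ofReal (t ^ α / kernelDenom lam α t x y) ≤
      ENNReal.ofReal (dominationConst α Cl) * majorant μ α t x y := by
  rcases le_or_gt t (dist x y) with hxy | hxy
  · simpa [div_self ht.ne'] using h.far_le hα ht ht hxy
  · have hCl := h.one_le
    have h2 := h.pos x (2 * t) (by positivity)
    have key : t ^ α / kernelDenom lam α t x y ≤ dominationConst α Cl * (lam x (2 * t))⁻¹ := by
      refine (h.div_kernelDenom_le hα ht x y).trans ((h.inv_le x ht).trans ?_)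
      gcongr
      rw [dominationConst]
      have : 0 ≤ 2 ^ α * Cl ^ 2 := by positivity
      linarith
    have hK0 : 0 ≤ dominationConst α Cl := by rw [dominationConst]; positivity
    refine (ENNReal.ofReal_le_ofReal key).trans ?_
    rw [ENNReal.ofReal_mul hK0]
    gcongr
    refine (h.ofReal_inv_le x (by positivity)).trans ?_
    simpa using le_majorant (μ := μ) α t (x := x) (y := y) 0 (by simpa using hxy)

/-- The kernel is extended by zero to `t ≤ 0` so that it is jointly measurable on all of `ℝ`. After
this the dominating function no longer appears. -/
theorem IsSquareKernel.isMajorized (h : IsUpperDoubling μ lam Cl) (hα : 0 < α)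
    {s : ℝ → Space n → Space n → 𝕜} (hs : IsSquareKernel lam α K s) :
    IsMajorized μ α (|K| * dominationConst α Cl).toNNReal
      (fun t x y => if 0 < t then s t x y else 0) := by
  have hC : ((|K| * dominationConst α Cl).toNNReal : ℝ≥0∞) =
      ENNReal.ofReal |K| * ENNReal.ofReal (dominationConst α Cl) :=
    ENNReal.ofReal_mul (abs_nonneg K)
  have hden : ∀ t, 0 < t → ∀ x y, 0 < kernelDenom lam α t x y := fun t ht x y => by
    have := h.pos x t ht
    exact lt_of_lt_of_le (by positivity) (h.kernelDenom_ge_left hα t x y)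
  have hsize : ∀ t, 0 < t → ∀ x y, ‖s t x y‖ ≤ |K| * (t ^ α / kernelDenom lam α t x y) := by
    intro t ht x y
    have := hden t ht x y
    refine (hs.size t ht x y).trans ?_
    gcongr
    exact le_abs_self K
  have hsize' : ∀ t, 0 < t → ∀ x y, ‖s t x y‖ₑ ≤
      ENNReal.ofReal |K| * ENNReal.ofReal (t ^ α / kernelDenom lam α t x y) := by
    intro t ht x y
    rw [← ENNReal.ofReal_mul (abs_nonneg K), ← ofReal_norm]
    exact ENNReal.ofReal_le_ofReal (hsize t ht x y)
  refine ⟨?_, ?_, ?_, ?_, ?_⟩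
  · have hS : MeasurableSet {p : ℝ × Space n × Space n | 0 < p.1} :=
      measurableSet_lt measurable_const measurable_fst
    have hf : Measurable fun p : {p : ℝ × Space n × Space n | 0 < p.1} =>
        s p.1.1 p.1.2.1 p.1.2.2 :=
      hs.measurable.comp (g := fun p => (s ((p : Set.Ioi (0 : ℝ) × Space n × Space n).1) p.2.1 p.2.2))
        (f := fun p : {p : ℝ × Space n × Space n | 0 < p.1} => (⟨p.1.1, p.2⟩, p.1.2))
        ((measurable_fst.comp measurable_subtype_coe).subtype_mk.prodMk
          (measurable_snd.comp measurable_subtype_coe))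
    classical
    have := hf.dite (measurable_const (a := (0 : 𝕜))) hS
    simpa only [Set.mem_ofPred_eq, dite_eq_ite] using this
  · intro t ht x
    refine ⟨|K| * (lam x t)⁻¹, fun y => ?_⟩
    simp only [ht, if_true]
    refine (hsize t ht x y).trans ?_
    gcongr
    exact h.div_kernelDenom_le hα ht x y
  · intro t ht x y
    simp only [ht, if_true]
    refine (hsize' t ht x y).trans ?_
    rw [hC, mul_assoc]
    gcongr
    exact h.size_le hα ht x y
  · intro t ht R hR x y hxy
    simp only [ht, if_true]
    refine (hsize' t ht x y).trans ?_
    rw [hC, mul_assoc, mul_assoc]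
    gcongr
    rw [← mul_assoc]
    exact h.far_le hα ht hR hxy
  · intro t ht x y z hyz
    simp only [ht, if_true]
    have hd := hden t ht x y
    have h1 : ‖s t x y - s t x z‖ ≤
        |K| * ((dist y z / t) ^ α * (t ^ α / kernelDenom lam α t x y)) := by
      rw [dist_eq_norm] at hyz ⊢
      refine (hs.smooth t ht x y z hyz).trans ?_
      have e : (‖y - z‖ / t) ^ α * (t ^ α / kernelDenom lam α t x y) =
          ‖y - z‖ ^ α / kernelDenom lam α t x y := by
        rw [Real.div_rpow (norm_nonneg _) ht.le]
        have : (0 : ℝ) < t ^ α := by positivity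
        field_simp
      rw [e]
      gcongr
      exact le_abs_self K
    rw [← ofReal_norm, hC]
    refine (ENNReal.ofReal_le_ofReal h1).trans ?_
    rw [ENNReal.ofReal_mul (abs_nonneg K), ENNReal.ofReal_mul (by positivity), mul_assoc, mul_assoc]
    refine mul_le_mul' le_rfl ?_
    rw [mul_left_comm]
    exact mul_le_mul' le_rfl (h.size_le hα ht x y)

end Domination

end Majorized

theorem add_sq_le_two_mul (a b : ℝ≥0∞) : (a + b) ^ 2 ≤ 2 * (a ^ 2 + b ^ 2) := by
  have := ENNReal.rpow_add_le_mul_rpow_add_rpow a b (p := 2) (by norm_num)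
  norm_num at this
  simpa using this

/-! ### Bounds for `θ_t` at a fixed `t` -/

section Operators

variable {n : ℕ} {μ : Measure (Space n)} {𝕜 : Type*} [RCLike 𝕜] {α : ℝ} {C : ℝ≥0}
  {s : ℝ → Space n → Space n → 𝕜} [SFinite μ]

/-- A bounded integrable function is in `L²`. This gives the absolute convergence of `θ_t f(x)` at
every point. -/
theorem integrable_mul_of_bounded {X : Type*} [MeasurableSpace X] {μ : Measure X} {φ g : X → 𝕜}
    {B : ℝ} (hφ : Integrable φ μ) (hB : ∀ x, ‖φ x‖ ≤ B) (hg : MemLp g 2 μ) :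
    Integrable (fun x => φ x * g x) μ := by
  have h2 : MemLp φ 2 μ := by
    rw [memLp_two_iff_integrable_sq_norm hφ.aestronglyMeasurable]
    refine (hφ.norm.const_mul B).mono' (hφ.aestronglyMeasurable.norm.pow 2)
      (Filter.Eventually.of_forall fun x => ?_)
    rw [Real.norm_of_nonneg (by positivity), sq]
    exact mul_le_mul_of_nonneg_right (hB x) (norm_nonneg _)
  exact h2.integrable_mul hg

namespace IsMajorized

variable (hs : IsMajorized μ α C s)
include hs

theorem measurable_slice (t : ℝ) (x : Space n) : Measurable (s t x) :=
  hs.measurable.comp (f := fun y => (t, x, y)) (by fun_prop)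

theorem integrable (hα : 0 < α) {t : ℝ} (ht : 0 < t) (x : Space n) : Integrable (s t x) μ := by
  refine ⟨(hs.measurable_slice t x).aestronglyMeasurable, ?_⟩
  refine lt_of_le_of_lt (lintegral_mono fun y => hs.size t ht x y) ?_
  rw [lintegral_const_mul _ ((measurable_majorant α t).of_uncurry_left)]
  exact ENNReal.mul_lt_top ENNReal.coe_lt_top
    ((lintegral_majorant_right_le α t x).trans_lt (majorantBound_lt_top hα))

theorem integrable_mul (hα : 0 < α) {t : ℝ} (ht : 0 < t) (x : Space n) {g : Space n → 𝕜}
    (hg : MemLp g 2 μ) : Integrable (fun y => s t x y * g y) μ := by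
  obtain ⟨B, hB⟩ := hs.bounded t ht x
  exact integrable_mul_of_bounded (hs.integrable hα ht x) hB hg

theorem measurable_theta {f : Space n → 𝕜} (hf : Measurable f) :
    Measurable fun p : ℝ × Space n => theta μ s p.1 f p.2 := by
  have h : Measurable fun p : (ℝ × Space n) × Space n => s p.1.1 p.1.2 p.2 * f p.2 :=
    (hs.measurable.comp (f := fun p : (ℝ × Space n) × Space n => (p.1.1, p.1.2, p.2))
      (by fun_prop)).mul (hf.comp measurable_snd)
  exact (StronglyMeasurable.integral_prod_right' h.stronglyMeasurable).measurable

theorem enorm_theta_le {t : ℝ} (ht : 0 < t) (g : Space n → 𝕜) (x : Space n) :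
    ‖theta μ s t g x‖ₑ ≤ C * ∫⁻ y, majorant μ α t x y * ‖g y‖ₑ ∂μ := by
  refine (enorm_integral_le_lintegral_enorm _).trans ?_
  rw [← lintegral_const_mul' _ _ ENNReal.coe_ne_top]
  refine lintegral_mono fun y => ?_
  rw [enorm_mul, ← mul_assoc]
  exact mul_le_mul' (hs.size t ht x y) le_rfl

/-- The gain for functions supported away from `x`. -/
theorem enorm_theta_le_of_ball {t R : ℝ} (ht : 0 < t) (hR : 0 < R) {g : Space n → 𝕜} {x : Space n}
    (hg : ∀ y, dist x y < R → g y = 0) :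
    ‖theta μ s t g x‖ₑ ≤
      C * ENNReal.ofReal ((t / R) ^ α) * ∫⁻ y, majorant μ α R x y * ‖g y‖ₑ ∂μ := by
  refine (enorm_integral_le_lintegral_enorm _).trans ?_
  rw [← lintegral_const_mul' _ _ (ENNReal.mul_ne_top ENNReal.coe_ne_top ENNReal.ofReal_ne_top)]
  refine lintegral_mono fun y => ?_
  rw [enorm_mul, ← mul_assoc]
  rcases lt_or_ge (dist x y) R with h | h
  · simp [hg y h]
  · exact mul_le_mul' (hs.far t ht R hR x y h) le_rfl

/-- The gain from cancellation. -/
theorem enorm_theta_le_of_mean_zero (hα : 0 < α) {ι : Type*} [MeasurableSpace ι] [Countable ι]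
    [DiscreteMeasurableSpace ι] {q : Space n → ι} (hq : Measurable q) {rep : ι → Space n} {t d : ℝ}
    (ht : 0 < t) (hd : d < t / 2) (hrep : ∀ y, dist y (rep (q y)) ≤ d) {g : Space n → 𝕜}
    (hg : MemLp g 2 μ) (hg0 : ∀ i, ∫ x in q ⁻¹' {i}, g x ∂μ = 0) (x : Space n) :
    ‖theta μ s t g x‖ₑ ≤
      C * ENNReal.ofReal ((d / t) ^ α) * ∫⁻ y, majorant μ α t x y * ‖g y‖ₑ ∂μ := by
  have hb : ∀ y, ‖s t x y - s t x (rep (q y))‖ₑ ≤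
      C * ENNReal.ofReal ((d / t) ^ α) * majorant μ α t x y := fun y => by
    refine (hs.smooth t ht x y _ ((hrep y).trans_lt hd)).trans ?_
    gcongr
    exact hrep y
  have hfin : C * ENNReal.ofReal ((d / t) ^ α) ≠ ∞ :=
    ENNReal.mul_ne_top ENNReal.coe_ne_top ENNReal.ofReal_ne_top
  have hmeas : Measurable fun y => s t x (rep (q y)) :=
    (measurable_of_countable fun i => s t x (rep i)).comp hq
  have i1 := hs.integrable hα ht x
  have i2 : Integrable (fun y => s t x y - s t x (rep (q y))) μ := by
    refine ⟨((hs.measurable_slice t x).sub hmeas).aestronglyMeasurable, ?_⟩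
    refine lt_of_le_of_lt (lintegral_mono hb) ?_
    rw [lintegral_const_mul' _ _ hfin]
    exact ENNReal.mul_lt_top hfin.lt_top
      ((lintegral_majorant_right_le α t x).trans_lt (majorantBound_lt_top hα))
  have i3 : Integrable (fun y => s t x (rep (q y))) μ := by
    refine (i1.sub i2).congr (Filter.Eventually.of_forall fun y => ?_)
    simp
  obtain ⟨B, hB⟩ := hs.bounded t ht x
  have i4 := integrable_mul_of_bounded i3 (fun y => hB _) hg
  -- The kernel frozen at the representative of each fibre is constant on fibres, so `g` annihilates
  -- it and it may be subtracted.
  have h0 : ∫ y, s t x (rep (q y)) * g y ∂μ = 0 :=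
    integral_comp_mul_eq_zero (φ := fun i => s t x (rep i)) hq hg0 i4
  have e : theta μ s t g x = ∫ y, (s t x y - s t x (rep (q y))) * g y ∂μ := by
    simp_rw [sub_mul]
    rw [integral_sub (hs.integrable_mul hα ht x hg) i4, h0, sub_zero, theta]
  rw [e]
  refine (enorm_integral_le_lintegral_enorm _).trans ?_
  rw [← lintegral_const_mul' _ _ hfin]
  refine lintegral_mono fun y => ?_
  rw [enorm_mul, ← mul_assoc]
  exact mul_le_mul' (hb y) le_rfl

theorem lintegral_theta_sq_le {t : ℝ} (ht : 0 < t) {g : Space n → 𝕜} (hg : Measurable g) :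
    ∫⁻ x, ‖theta μ s t g x‖ₑ ^ 2 ∂μ ≤
      (C * majorantBound α) ^ 2 * ∫⁻ y, ‖g y‖ₑ ^ 2 ∂μ := by
  refine (lintegral_mono fun x => pow_le_pow_left' (hs.enorm_theta_le ht g x) 2).trans ?_
  simp only [mul_pow]
  rw [lintegral_const_mul' _ _ (by simp)]
  refine (mul_le_mul' le_rfl (sq_lintegral_majorant_le α t hg.enorm)).trans_eq ?_
  ring

theorem lintegral_theta_sq_le_of_mean_zero (hα : 0 < α) {ι : Type*} [MeasurableSpace ι]
    [Countable ι] [DiscreteMeasurableSpace ι] {q : Space n → ι} (hq : Measurable q)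
    {rep : ι → Space n} {t d : ℝ} (ht : 0 < t) (hd : d < t / 2)
    (hrep : ∀ y, dist y (rep (q y)) ≤ d) {g : Space n → 𝕜} (hgm : Measurable g)
    (hg : MemLp g 2 μ) (hg0 : ∀ i, ∫ x in q ⁻¹' {i}, g x ∂μ = 0) :
    ∫⁻ x, ‖theta μ s t g x‖ₑ ^ 2 ∂μ ≤
      (C * ENNReal.ofReal ((d / t) ^ α) * majorantBound α) ^ 2 * ∫⁻ y, ‖g y‖ₑ ^ 2 ∂μ := by
  refine (lintegral_mono fun x => pow_le_pow_left'
    (hs.enorm_theta_le_of_mean_zero hα hq ht hd hrep hg hg0 x) 2).trans ?_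
  simp only [mul_pow]
  rw [lintegral_const_mul' _ _ (by simp [ENNReal.mul_eq_top])]
  refine (mul_le_mul' le_rfl (sq_lintegral_majorant_le α t hgm.enorm)).trans_eq ?_
  ring

/-- The difference is `θ_t` applied to `g - g x`, which vanishes on the ball of radius `R` around
`x`, so only the off-diagonal decay of the kernel is seen. -/
theorem enorm_theta_sub_mul_le (hα : 0 < α) {t R : ℝ} (ht : 0 < t) (hR : 0 < R) {g : Space n → 𝕜}
    (hgm : Measurable g) (hg : MemLp g 2 μ) {x : Space n} (hx : ∀ y, dist x y < R → g y = g x) :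
    ‖theta μ s t g x - g x * theta μ s t 1 x‖ₑ ≤ C * ENNReal.ofReal ((t / R) ^ α) *
      (∫⁻ y, majorant μ α R x y * ‖g y‖ₑ ∂μ + majorantBound α * ‖g x‖ₑ) := by
  have e : theta μ s t g x - g x * theta μ s t 1 x = theta μ s t (fun y => g y - g x) x := by
    simp only [theta, Pi.one_apply, mul_one, mul_sub]
    rw [integral_sub (hs.integrable_mul hα ht x hg) ((hs.integrable hα ht x).mul_const _),
      integral_mul_const, mul_comm (g x)]
  rw [e]
  refine (hs.enorm_theta_le_of_ball ht hR fun y hy => by rw [hx y hy, sub_self]).trans ?_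
  gcongr
  have hm : Measurable (majorant μ α R x) := (measurable_majorant α R).of_uncurry_left
  calc ∫⁻ y, majorant μ α R x y * ‖g y - g x‖ₑ ∂μ
      ≤ ∫⁻ y, (majorant μ α R x y * ‖g y‖ₑ + majorant μ α R x y * ‖g x‖ₑ) ∂μ := by
        refine lintegral_mono fun y => ?_
        rw [← mul_add]
        exact mul_le_mul' le_rfl enorm_sub_le
    _ = ∫⁻ y, majorant μ α R x y * ‖g y‖ₑ ∂μ + (∫⁻ y, majorant μ α R x y ∂μ) * ‖g x‖ₑ := by
        have hm' : Measurable fun y => majorant μ α R x y * ‖g y‖ₑ := hm.mul hgm.enorm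
        rw [lintegral_add_left hm', lintegral_mul_const _ hm]
    _ ≤ _ := by
        gcongr
        exact lintegral_majorant_right_le α R x

theorem setLIntegral_theta_sub_mul_sq_le (hα : 0 < α) {t R : ℝ} (ht : 0 < t) (hR : 0 < R)
    {g : Space n → 𝕜} (hgm : Measurable g) (hg : MemLp g 2 μ) {G : Set (Space n)}
    (hG : MeasurableSet G) (hx : ∀ x ∈ G, ∀ y, dist x y < R → g y = g x) :
    ∫⁻ x in G, ‖theta μ s t g x - g x * theta μ s t 1 x‖ₑ ^ 2 ∂μ ≤
      4 * (C * ENNReal.ofReal ((t / R) ^ α) * majorantBound α) ^ 2 * ∫⁻ y, ‖g y‖ₑ ^ 2 ∂μ := by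
  have hfin : 2 * (C * ENNReal.ofReal ((t / R) ^ α)) ^ 2 ≠ ∞ := by
    simp [ENNReal.mul_eq_top]
  calc _ ≤ ∫⁻ x in G, 2 * (C * ENNReal.ofReal ((t / R) ^ α)) ^ 2 *
        ((∫⁻ y, majorant μ α R x y * ‖g y‖ₑ ∂μ) ^ 2 + majorantBound α ^ 2 * ‖g x‖ₑ ^ 2) ∂μ := by
        refine setLIntegral_mono' hG fun x hxG => ?_
        refine (pow_le_pow_left' (hs.enorm_theta_sub_mul_le hα ht hR hgm hg (hx x hxG)) 2).trans ?_
        rw [mul_pow, mul_comm 2, mul_assoc, ← mul_pow (majorantBound α)]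
        exact mul_le_mul' le_rfl (add_sq_le_two_mul _ _)
    _ ≤ ∫⁻ x, 2 * (C * ENNReal.ofReal ((t / R) ^ α)) ^ 2 *
        ((∫⁻ y, majorant μ α R x y * ‖g y‖ₑ ∂μ) ^ 2 + majorantBound α ^ 2 * ‖g x‖ₑ ^ 2) ∂μ :=
        setLIntegral_le_lintegral _ _
    _ = 2 * (C * ENNReal.ofReal ((t / R) ^ α)) ^ 2 *
        (∫⁻ x, (∫⁻ y, majorant μ α R x y * ‖g y‖ₑ ∂μ) ^ 2 ∂μ +
          majorantBound α ^ 2 * ∫⁻ x, ‖g x‖ₑ ^ 2 ∂μ) := by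
        rw [lintegral_const_mul' _ _ hfin, lintegral_add_right _
          ((hgm.enorm.pow_const 2).const_mul _), lintegral_const_mul _ (hgm.enorm.pow_const 2)]
    _ ≤ 2 * (C * ENNReal.ofReal ((t / R) ^ α)) ^ 2 *
        (majorantBound α ^ 2 * ∫⁻ x, ‖g x‖ₑ ^ 2 ∂μ +
          majorantBound α ^ 2 * ∫⁻ x, ‖g x‖ₑ ^ 2 ∂μ) := by
        gcongr
        exact sq_lintegral_majorant_le α R hgm.enorm
    _ = _ := by ring

theorem enorm_theta_one_sub_le (hα : 0 < α) {t R : ℝ} (ht : 0 < t) (hR : 0 < R)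
    {B : Set (Space n)} (hB : MeasurableSet B) {x : Space n} (hx : Metric.ball x R ⊆ B) :
    ‖theta μ s t 1 x - theta μ s t (B.indicator 1) x‖ₑ ≤
      C * ENNReal.ofReal ((t / R) ^ α) * majorantBound α := by
  have i1 := hs.integrable hα ht x
  have e : theta μ s t 1 x - theta μ s t (B.indicator 1) x =
      theta μ s t (fun y => 1 - B.indicator 1 y) x := by
    simp only [theta, Pi.one_apply, mul_one, mul_sub]
    rw [integral_sub i1]
    refine (i1.indicator hB).congr (Filter.Eventually.of_forall fun y => ?_)
    by_cases hy : y ∈ B <;> simp [hy]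
  rw [e]
  refine (hs.enorm_theta_le_of_ball ht hR fun y hy => ?_).trans ?_
  · rw [Set.indicator_of_mem (hx (by rwa [Metric.mem_ball, dist_comm]))]
    simp
  · gcongr
    refine le_trans (lintegral_mono fun y => ?_) (lintegral_majorant_right_le α R x)
    refine mul_le_of_le_one_right' ?_
    by_cases hy : y ∈ B <;> simp [hy]

end IsMajorized

end Operators

/-! ### Randomly shifted dyadic grids and good points -/

section Grids

variable {n : ℕ}

/-- The index of the half-open cube containing `x` in the grid of mesh `ℓ` shifted by `u`. -/
noncomputable def gridIndex (u : Space n) (ℓ : ℝ) (x : Space n) : Fin n → ℤ :=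
  fun c => ⌊(x c - u c) / ℓ⌋

/-- The centre of the cube with a given index. -/
noncomputable def gridCenter (u : Space n) (ℓ : ℝ) (i : Fin n → ℤ) : Space n :=
  fun c => u c + (i c + 1 / 2) * ℓ

theorem measurable_gridIndex (u : Space n) (ℓ : ℝ) : Measurable (gridIndex u ℓ) :=
  measurable_pi_lambda _ fun c => Int.measurable_floor.comp (by fun_prop)

theorem dist_gridCenter_le (u : Space n) {ℓ : ℝ} (hℓ : 0 < ℓ) (x : Space n) :
    dist x (gridCenter u ℓ (gridIndex u ℓ x)) ≤ ℓ / 2 := by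
  refine (dist_pi_le_iff (by positivity)).2 fun c => ?_
  simp only [gridCenter, gridIndex, Real.dist_eq]
  have h1 := Int.floor_le ((x c - u c) / ℓ)
  have h2 := Int.lt_floor_add_one ((x c - u c) / ℓ)
  rw [le_div_iff₀ hℓ] at h1
  rw [div_lt_iff₀ hℓ] at h2
  rw [abs_le]
  constructor <;> linarith

theorem gridIndex_eq_of_dist_lt (u : Space n) {ℓ : ℝ} (hℓ : 0 < ℓ) {i : Fin n → ℤ} {y : Space n}
    (h : dist y (gridCenter u ℓ i) < ℓ / 2) : gridIndex u ℓ y = i := by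
  ext c
  have hc := (dist_le_pi_dist y (gridCenter u ℓ i) c).trans_lt h
  rw [Real.dist_eq, abs_lt] at hc
  simp only [gridCenter] at hc
  simp only [gridIndex]
  rw [Int.floor_eq_iff, le_div_iff₀ hℓ, div_lt_iff₀ hℓ]
  constructor <;> linarith [hc.1, hc.2]

/-- Nestedness of grids with a common corner `u`: the index of the parent cube is the integer half
of the index of the child. -/
theorem gridIndex_two_mul (u : Space n) (ℓ : ℝ) (x : Space n) :
    gridIndex u (2 * ℓ) x = fun c => gridIndex u ℓ x c / 2 := by
  ext c
  simp only [gridIndex]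
  rw [mul_comm, ← div_div]
  set a := (x c - u c) / ℓ
  have h1 := Int.floor_le a
  have h2 := Int.lt_floor_add_one a
  have h3 : ⌊a⌋ = 2 * (⌊a⌋ / 2) + ⌊a⌋ % 2 := by omega
  have h4 : (⌊a⌋ % 2 = 0 ∨ ⌊a⌋ % 2 = 1) := by omega
  have h5 : (⌊a⌋ : ℝ) = 2 * ((⌊a⌋ / 2 : ℤ) : ℝ) + ((⌊a⌋ % 2 : ℤ) : ℝ) := by exact_mod_cast h3
  rw [Int.floor_eq_iff]
  rcases h4 with h | h <;> rw [h] at h5 <;> push_cast at h5 <;> constructor <;> linarith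

theorem measure_gridIndex_lt_top (μ : Measure (Space n)) [IsFiniteMeasureOnCompacts μ]
    (u : Space n) {ℓ : ℝ} (hℓ : 0 < ℓ) (i : Fin n → ℤ) : μ (gridIndex u ℓ ⁻¹' {i}) < ∞ := by
  refine lt_of_le_of_lt (measure_mono ?_) (measure_closedBall_lt_top (x := gridCenter u ℓ i)
    (r := ℓ / 2))
  intro x hx
  have : gridIndex u ℓ x = i := hx
  rw [← this]
  exact dist_gridCenter_le u hℓ x

/-- `x` has distance at least `ε ℓ` to the boundary of the grid cube containing it. -/
def IsInner (u : Space n) (ℓ ε : ℝ) (x : Space n) : Prop :=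
  dist x (gridCenter u ℓ (gridIndex u ℓ x)) ≤ (1 / 2 - ε) * ℓ

theorem IsInner.gridIndex_eq {u : Space n} {ℓ ε : ℝ} (hℓ : 0 < ℓ) {x y : Space n}
    (hx : IsInner u ℓ ε x) (h : dist x y < ε * ℓ) : gridIndex u ℓ y = gridIndex u ℓ x := by
  refine gridIndex_eq_of_dist_lt u hℓ ?_
  have := dist_triangle y x (gridCenter u ℓ (gridIndex u ℓ x))
  rw [dist_comm y x] at this
  rw [IsInner] at hx
  linarith

theorem IsInner.ball_subset {u : Space n} {ℓ ε r ρ : ℝ} {x : Space n}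
    (hx : IsInner u ℓ ε x) (h : r + ρ ≤ ε * ℓ) :
    Metric.ball x r ⊆ Metric.closedBall (gridCenter u ℓ (gridIndex u ℓ x)) (ℓ / 2 - ρ) := by
  intro y hy
  rw [Metric.mem_ball] at hy
  have := dist_triangle y x (gridCenter u ℓ (gridIndex u ℓ x))
  rw [IsInner] at hx
  rw [Metric.mem_closedBall]
  linarith

theorem measurableSet_isInner (ℓ ε : ℝ) :
    MeasurableSet {p : Space n × Space n | IsInner p.1 ℓ ε p.2} := by
  refine measurableSet_le (measurable_snd.dist ?_) measurable_const
  refine measurable_pi_lambda _ fun c => ?_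
  have h : Measurable fun p : Space n × Space n => ((⌊(p.2 c - p.1 c) / ℓ⌋ : ℤ) : ℝ) :=
    (measurable_of_countable (fun z : ℤ => (z : ℝ))).comp (Int.measurable_floor.comp (by fun_prop))
  simp only [gridCenter, gridIndex]
  fun_prop

/-- The uniform distribution on `[0, L)`. -/
noncomputable def uniformShift (L : ℝ) : Measure ℝ :=
  (ENNReal.ofReal L)⁻¹ • volume.restrict (Set.Ico 0 L)

theorem isProbabilityMeasure_uniformShift {L : ℝ} (hL : 0 < L) :
    IsProbabilityMeasure (uniformShift L) := by
  refine ⟨?_⟩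
  rw [uniformShift, Measure.smul_apply, Measure.restrict_apply_univ, Real.volume_Ico, sub_zero,
    smul_eq_mul]
  exact ENNReal.inv_mul_cancel (by simpa using hL) ENNReal.ofReal_ne_top

/-- The bad shifts in one coordinate lie within `ε ℓ` of a point of `x + ℓ ℤ`. At most `2 ^ m + 2`
such intervals matter for shifts in `[0, 2 ^ m ℓ)`, and `(2 ^ m + 2) / 2 ^ m ≤ 3` makes the
probability at most `3 · 2 ε`. -/
theorem uniformShift_near_boundary_le {ℓ ε : ℝ} (hℓ : 0 < ℓ) (hε : 0 ≤ ε) (m : ℕ) (x : ℝ) :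
    uniformShift (2 ^ m * ℓ) {v | (1 / 2 - ε) * ℓ < dist x (v + (⌊(x - v) / ℓ⌋ + 1 / 2) * ℓ)} ≤
      ENNReal.ofReal (6 * ε) := by
  have hL : 0 < 2 ^ m * ℓ := by positivity
  rw [uniformShift, Measure.smul_apply, smul_eq_mul, Measure.restrict_apply' measurableSet_Ico]
  have hsub : {v | (1 / 2 - ε) * ℓ < dist x (v + (⌊(x - v) / ℓ⌋ + 1 / 2) * ℓ)} ∩
      Set.Ico 0 (2 ^ m * ℓ) ⊆ ⋃ p ∈ Finset.range (2 ^ m + 2),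
        Set.Icc (x - (⌊x / ℓ⌋ + 1 - (p : ℝ)) * ℓ - ε * ℓ)
          (x - (⌊x / ℓ⌋ + 1 - (p : ℝ)) * ℓ + ε * ℓ) := by
    rintro v ⟨hv, hv0, hvL⟩
    simp only [Set.mem_ofPred_eq, Real.dist_eq] at hv
    set a := (x - v) / ℓ with ha
    have hva : v = x - a * ℓ := by rw [ha]; field_simp; ring
    have h1 := Int.floor_le a
    have h2 := Int.lt_floor_add_one a
    have hax : a ≤ x / ℓ := by rw [ha]; gcongr; linarith
    have hxa : x / ℓ - (2 ^ m : ℤ) ≤ a := by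
      rw [ha, le_div_iff₀ hℓ, sub_mul, div_mul_cancel₀ _ hℓ.ne']
      push_cast; linarith
    have hf1 : ⌊a⌋ ≤ ⌊x / ℓ⌋ := Int.floor_le_floor hax
    have hf2 : ⌊x / ℓ⌋ - 2 ^ m ≤ ⌊a⌋ := by
      have := Int.floor_le_floor hxa
      rwa [Int.floor_sub_intCast] at this
    -- In units of the mesh, a large distance to the centre of the cell means that `a` is close to
    -- one of the two integers bounding it.
    have hz : ∃ z : ℤ, ⌊x / ℓ⌋ - 2 ^ m ≤ z ∧ z ≤ ⌊x / ℓ⌋ + 1 ∧ |a - z| ≤ ε := by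
      have e : x - (v + (⌊a⌋ + 1 / 2) * ℓ) = (a - ⌊a⌋ - 1 / 2) * ℓ := by rw [hva]; ring
      rw [e, abs_mul, abs_of_pos hℓ] at hv
      have hv' := lt_of_mul_lt_mul_right hv hℓ.le
      rcases lt_abs.1 hv' with h | h
      · refine ⟨⌊a⌋ + 1, by omega, by omega, ?_⟩
        rw [abs_le]; push_cast; constructor <;> linarith
      · refine ⟨⌊a⌋, by omega, by omega, ?_⟩
        rw [abs_le]; constructor <;> linarith
    obtain ⟨z, hz1, hz2, hz3⟩ := hz
    obtain ⟨p, hp⟩ := Int.eq_ofNat_of_zero_le (show 0 ≤ ⌊x / ℓ⌋ + 1 - z by omega)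
    have hpz : (z : ℝ) = ⌊x / ℓ⌋ + 1 - (p : ℝ) := by
      have : z = ⌊x / ℓ⌋ + 1 - p := by omega
      rw [this]; push_cast; ring
    simp only [Set.mem_iUnion, Finset.mem_range]
    refine ⟨p, ?_, ?_⟩
    · have : (p : ℤ) < 2 ^ m + 2 := by omega
      exact_mod_cast this
    · rw [← hpz, hva, Set.mem_Icc]
      rw [abs_le] at hz3
      constructor <;> nlinarith [hz3.1, hz3.2]
  calc (ENNReal.ofReal (2 ^ m * ℓ))⁻¹ * volume ({v | (1 / 2 - ε) * ℓ <
        dist x (v + (⌊(x - v) / ℓ⌋ + 1 / 2) * ℓ)} ∩ Set.Ico 0 (2 ^ m * ℓ))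
      ≤ (ENNReal.ofReal (2 ^ m * ℓ))⁻¹ * ∑ p ∈ Finset.range (2 ^ m + 2),
        volume (Set.Icc (x - (⌊x / ℓ⌋ + 1 - (p : ℝ)) * ℓ - ε * ℓ)
          (x - (⌊x / ℓ⌋ + 1 - (p : ℝ)) * ℓ + ε * ℓ)) := by
        gcongr
        exact (measure_mono hsub).trans (measure_biUnion_finset_le _ _)
    _ = ENNReal.ofReal ((2 ^ m * ℓ)⁻¹ * ((2 ^ m + 2) * (2 * (ε * ℓ)))) := by
        have : ∀ c : ℝ, c + ε * ℓ - (c - ε * ℓ) = 2 * (ε * ℓ) := fun c => by ring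
        simp only [Real.volume_Icc, this, Finset.sum_const, Finset.card_range, nsmul_eq_mul]
        rw [← ENNReal.ofReal_inv_of_pos hL,
          ENNReal.ofReal_mul (p := (2 ^ m * ℓ)⁻¹) (by positivity),
          ENNReal.ofReal_mul (p := 2 ^ m + 2) (by positivity)]
        congr 2
        rw [← ENNReal.ofReal_natCast]
        push_cast
        rfl
    _ ≤ _ := by
        refine ENNReal.ofReal_le_ofReal ?_
        have h1 : (1 : ℝ) ≤ 2 ^ m := one_le_pow₀ one_le_two
        have : (2 ^ m * ℓ)⁻¹ * ((2 ^ m + 2) * (2 * (ε * ℓ))) = 2 * ε * ((2 ^ m + 2) / 2 ^ m) := by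
          field_simp
        rw [this]
        have h3 : ((2 : ℝ) ^ m + 2) / 2 ^ m ≤ 3 := by
          rw [div_le_iff₀ (by positivity)]; linarith
        nlinarith

/-- The distribution of the random shift of the grids. -/
noncomputable def shiftMeasure (n : ℕ) (L : ℝ) : Measure (Space n) :=
  Measure.pi fun _ => uniformShift L

theorem isProbabilityMeasure_shiftMeasure {L : ℝ} (hL : 0 < L) :
    IsProbabilityMeasure (shiftMeasure n L) := by
  have := isProbabilityMeasure_uniformShift hL
  rw [shiftMeasure]
  infer_instance

theorem shiftMeasure_not_isInner_le {ℓ ε : ℝ} (hℓ : 0 < ℓ) (hε : 0 ≤ ε) (hε' : ε ≤ 1 / 2) (m : ℕ)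
    (x : Space n) :
    shiftMeasure n (2 ^ m * ℓ) {u | ¬ IsInner u ℓ ε x} ≤ n * ENNReal.ofReal (6 * ε) := by
  have := isProbabilityMeasure_uniformShift (L := 2 ^ m * ℓ) (by positivity)
  set B : Fin n → Set ℝ := fun c =>
    {v | (1 / 2 - ε) * ℓ < dist (x c) (v + (⌊(x c - v) / ℓ⌋ + 1 / 2) * ℓ)} with hB
  have hBm : ∀ c, MeasurableSet (B c) := fun c => by
    refine measurableSet_lt measurable_const (measurable_const.dist ?_)
    have h : Measurable fun v : ℝ => ((⌊(x c - v) / ℓ⌋ : ℤ) : ℝ) :=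
      (measurable_of_countable (fun z : ℤ => (z : ℝ))).comp
        (Int.measurable_floor.comp (by fun_prop))
    fun_prop
  have hsub : {u | ¬ IsInner u ℓ ε x} ⊆ ⋃ c, (Function.eval c) ⁻¹' B c := by
    intro u hu
    by_contra hc
    simp only [Set.mem_iUnion, Set.mem_preimage, hB, Set.mem_ofPred_eq, not_exists, not_lt] at hc
    refine hu ((dist_pi_le_iff ?_).2 hc)
    have : 0 ≤ 1 / 2 - ε := by linarith
    positivity
  calc shiftMeasure n (2 ^ m * ℓ) {u | ¬ IsInner u ℓ ε x}
      ≤ ∑ c, shiftMeasure n (2 ^ m * ℓ) ((Function.eval c) ⁻¹' B c) :=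
        (measure_mono hsub).trans (measure_iUnion_fintype_le _ _)
    _ = ∑ c, uniformShift (2 ^ m * ℓ) (B c) := by
        refine Finset.sum_congr rfl fun c _ => ?_
        exact (measurePreserving_eval (fun _ : Fin n => uniformShift (2 ^ m * ℓ)) c).measure_preimage
          (hBm c).nullMeasurableSet
    _ ≤ ∑ _c : Fin n, ENNReal.ofReal (6 * ε) :=
        Finset.sum_le_sum fun c _ => uniformShift_near_boundary_le hℓ hε m (x c)
    _ = _ := by simp

/-- The margin in the definition of good points. -/
noncomputable def margin (n k i : ℕ) : ℝ := (48 * (n + 1) : ℝ)⁻¹ * (3 / 4) ^ (i - k)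

theorem margin_pos (n k i : ℕ) : 0 < margin n k i := by rw [margin]; positivity

theorem margin_le (n k i : ℕ) : margin n k i ≤ 1 / 48 := by
  rw [margin]
  have h1 : ((3 : ℝ) / 4) ^ (i - k) ≤ 1 := pow_le_one₀ (by norm_num) (by norm_num)
  have h2 : (48 * (n + 1) : ℝ)⁻¹ ≤ 1 / 48 := by
    rw [inv_eq_one_div]
    refine div_le_div_of_nonneg_left zero_le_one (by norm_num) ?_
    have : (0 : ℝ) ≤ n := n.cast_nonneg
    linarith
  calc _ ≤ (48 * (n + 1) : ℝ)⁻¹ * 1 := by gcongr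
    _ ≤ _ := by linarith

/-- `x` is good at level `k` if it stays away from the boundaries of all coarser grids. -/
def IsGood (u : Space n) (δ : ℝ) (N k : ℕ) (x : Space n) : Prop :=
  ∀ i, k ≤ i → i ≤ N → IsInner u (δ * 2 ^ i) (margin n k i) x

theorem measurableSet_isGood (δ : ℝ) (N k : ℕ) :
    MeasurableSet {p : Space n × Space n | IsGood p.1 δ N k p.2} := by
  have : {p : Space n × Space n | IsGood p.1 δ N k p.2} =
      ⋂ i, ⋂ (_ : k ≤ i), ⋂ (_ : i ≤ N),
        {p : Space n × Space n | IsInner p.1 (δ * 2 ^ i) (margin n k i) p.2} := by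
    ext p; simp [IsGood]
  rw [this]
  exact .iInter fun i => .iInter fun _ => .iInter fun _ => measurableSet_isInner _ _

theorem measurableSet_isGood_right (u : Space n) (δ : ℝ) (N k : ℕ) :
    MeasurableSet {x | IsGood u δ N k x} :=
  measurable_prodMk_left (measurableSet_isGood δ N k)

/-- Union bound over the levels `i`: the shift range `δ 2^N` is a power-of-two multiple of every
mesh, so level `i` fails with probability at most `6 n` times its margin. Since `∑ (3/4)^m ≤ 4`, the
total is at most `24 n / (48 (n + 1)) ≤ 1/2`, which fixes the constant in `margin`. -/
theorem half_le_shiftMeasure_isGood {δ : ℝ} (hδ : 0 < δ) (N k : ℕ) (x : Space n) :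
    1 / 2 ≤ shiftMeasure n (δ * 2 ^ N) {u | IsGood u δ N k x} := by
  have := isProbabilityMeasure_shiftMeasure (n := n) (L := δ * 2 ^ N) (by positivity)
  have hm : MeasurableSet {u | IsGood u δ N k x} :=
    measurable_prodMk_right (measurableSet_isGood δ N k)
  have hbad : shiftMeasure n (δ * 2 ^ N) {u | IsGood u δ N k x}ᶜ ≤ 1 / 2 := by
    have hsub : {u | IsGood u δ N k x}ᶜ ⊆ ⋃ i ∈ Finset.Icc k N,
        {u | ¬ IsInner u (δ * 2 ^ i) (margin n k i) x} := by
      intro u hu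
      simp only [Set.mem_compl_iff, Set.mem_ofPred_eq, IsGood, not_forall] at hu
      obtain ⟨i, h1, h2, h3⟩ := hu
      simp only [Set.mem_iUnion, Finset.mem_Icc]
      exact ⟨i, ⟨h1, h2⟩, h3⟩
    calc shiftMeasure n (δ * 2 ^ N) {u | IsGood u δ N k x}ᶜ
        ≤ ∑ i ∈ Finset.Icc k N, shiftMeasure n (δ * 2 ^ N)
            {u | ¬ IsInner u (δ * 2 ^ i) (margin n k i) x} :=
          (measure_mono hsub).trans (measure_biUnion_finset_le _ _)
      _ ≤ ∑ i ∈ Finset.Icc k N, n * ENNReal.ofReal (6 * margin n k i) := by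
          refine Finset.sum_le_sum fun i hi => ?_
          have hiN := (Finset.mem_Icc.1 hi).2
          have e : δ * 2 ^ N = 2 ^ (N - i) * (δ * 2 ^ i) := by
            rw [mul_left_comm, ← pow_add, Nat.sub_add_cancel hiN]
          rw [e]
          exact shiftMeasure_not_isInner_le (by positivity) (margin_pos n k i).le
            ((margin_le n k i).trans (by norm_num)) _ x
      _ = ENNReal.ofReal (n * (6 * (48 * (n + 1) : ℝ)⁻¹ *
            ∑ i ∈ Finset.Icc k N, (3 / 4 : ℝ) ^ (i - k))) := by
          rw [← Finset.mul_sum, ← ENNReal.ofReal_sum_of_nonneg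
            (fun i _ => by have := margin_pos n k i; positivity),
            ENNReal.ofReal_mul (Nat.cast_nonneg n), ENNReal.ofReal_natCast, Finset.mul_sum]
          congr 3 with i
          rw [margin]; ring
      _ ≤ ENNReal.ofReal (1 / 2) := by
          refine ENNReal.ofReal_le_ofReal ?_
          have hsum : ∑ i ∈ Finset.Icc k N, (3 / 4 : ℝ) ^ (i - k) ≤ 4 := by
            rw [← Finset.Ico_add_one_right_eq_Icc, Finset.sum_Ico_eq_sum_range]
            simp only [Nat.add_sub_cancel_left]
            refine (Summable.sum_le_tsum _ (fun i _ => by positivity)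
              (summable_geometric_of_lt_one (by norm_num) (by norm_num))).trans ?_
            rw [tsum_geometric_of_lt_one (by norm_num) (by norm_num)]
            norm_num
          have hn : (0 : ℝ) ≤ n := n.cast_nonneg
          calc _ ≤ (n : ℝ) * (6 * (48 * (n + 1) : ℝ)⁻¹ * 4) := by gcongr
            _ = 1 / 2 * (n / (n + 1)) := by field_simp; ring
            _ ≤ 1 / 2 * 1 := by
                gcongr
                rw [div_le_one (by positivity)]; linarith
            _ = _ := by norm_num
      _ = 1 / 2 := by
          rw [ENNReal.ofReal_div_of_pos two_pos]; simp
  have htot := prob_add_prob_compl (μ := shiftMeasure n (δ * 2 ^ N)) hm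
  by_contra! hlt
  have h1 : shiftMeasure n (δ * 2 ^ N) {u | IsGood u δ N k x} +
      shiftMeasure n (δ * 2 ^ N) {u | IsGood u δ N k x}ᶜ < 1 / 2 + 1 / 2 :=
    ENNReal.add_lt_add_of_lt_of_le (by simp) hlt hbad
  rw [htot, ENNReal.add_halves] at h1
  exact lt_irrefl _ h1

end Grids

/-! ### Martingale decomposition and Carleson embedding -/

section Martingale

variable {X ι : Type*} [MeasurableSpace X] [MeasurableSpace ι] [Countable ι]
  [DiscreteMeasurableSpace ι] {𝕜 : Type*} [RCLike 𝕜] {μ : Measure X} {q : ℕ → X → ι}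

/-- The successive averages of `f` over coarser and coarser partitions, starting with `f`. -/
noncomputable def martingale (μ : Measure X) (q : ℕ → X → ι) (f : X → 𝕜) : ℕ → X → 𝕜
  | 0 => f
  | j + 1 => fiberAverage μ (q j) (martingale μ q f j)

/-- The successive averages of a `[0, ∞]`-valued function. -/
noncomputable def lmartingale (μ : Measure X) (q : ℕ → X → ι) (F : X → ℝ≥0∞) : ℕ → X → ℝ≥0∞
  | 0 => F
  | j + 1 => fiberLAverage μ (q j) (lmartingale μ q F j)

theorem enorm_martingale_le (f : X → 𝕜) (j : ℕ) (x : X) :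
    ‖martingale μ q f j x‖ₑ ≤ lmartingale μ q (fun y => ‖f y‖ₑ) j x := by
  induction j generalizing x with
  | zero => exact le_rfl
  | succ j ih => exact enorm_fiberAverage_le ih x

theorem measurable_martingale (hq : ∀ i, Measurable (q i)) {f : X → 𝕜} (hf : Measurable f)
    (j : ℕ) : Measurable (martingale μ q f j) := by
  cases j with
  | zero => exact hf
  | succ j => exact measurable_fiberAverage (hq j) _

theorem measurable_lmartingale (hq : ∀ i, Measurable (q i)) {F : X → ℝ≥0∞} (hF : Measurable F)
    (j : ℕ) : Measurable (lmartingale μ q F j) := by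
  cases j with
  | zero => exact hF
  | succ j => exact measurable_fiberLAverage (hq j) _

theorem memLp_martingale (hq : ∀ i, Measurable (q i)) (hfin : ∀ j i, μ (q j ⁻¹' {i}) < ∞)
    {f : X → 𝕜} (hf : MemLp f 2 μ) (j : ℕ) : MemLp (martingale μ q f j) 2 μ := by
  induction j with
  | zero => exact hf
  | succ j ih => exact memLp_fiberAverage (hq j) (hfin j) ih

theorem fiber_eq_of_le {r : ℕ → ι → ι} (hr : ∀ j x, q (j + 1) x = r j (q j x)) {i j : ℕ}
    (hij : i ≤ j) {x y : X} (h : q i x = q i y) : q j x = q j y := by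
  induction j, hij using Nat.le_induction with
  | base => exact h
  | succ j _ ih => rw [hr, hr, ih]

theorem martingale_eq {r : ℕ → ι → ι} (hr : ∀ j x, q (j + 1) x = r j (q j x)) (f : X → 𝕜)
    {i j : ℕ} (hij : i < j) {x y : X} (h : q i x = q i y) :
    martingale μ q f j x = martingale μ q f j y := by
  obtain ⟨j, rfl⟩ := Nat.exists_eq_succ_of_ne_zero (Nat.ne_zero_of_lt hij)
  exact fiberAverage_congr (fiber_eq_of_le hr (Nat.lt_succ_iff.1 hij) h)

/-- The pieces in the martingale decomposition of `f` with `N + 1` steps. -/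
noncomputable def piece (μ : Measure X) (q : ℕ → X → ι) (f : X → 𝕜) (N j : ℕ) (x : X) : 𝕜 :=
  if j ≤ N then martingale μ q f j x - martingale μ q f (j + 1) x else martingale μ q f (N + 1) x

theorem measurable_piece (hq : ∀ i, Measurable (q i)) {f : X → 𝕜} (hf : Measurable f)
    (N j : ℕ) : Measurable (piece μ q f N j) := by
  have := measurable_martingale (μ := μ) hq hf
  unfold piece
  split_ifs
  · exact (this j).sub (this (j + 1))
  · exact this (N + 1)

theorem memLp_piece (hq : ∀ i, Measurable (q i)) (hfin : ∀ j i, μ (q j ⁻¹' {i}) < ∞)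
    {f : X → 𝕜} (hf : MemLp f 2 μ) (N j : ℕ) : MemLp (piece μ q f N j) 2 μ := by
  have := memLp_martingale hq hfin hf
  unfold piece
  split_ifs
  · exact (this j).sub (this (j + 1))
  · exact this (N + 1)

/-- Indices are shifted by one: `martingale j` averages over the partition `j - 1`. Hence the piece
`j` is constant on the cells of level `j - 1`, while for `j ≤ N` its mean vanishes on those of level
`j`. -/
theorem piece_eq {r : ℕ → ι → ι} (hr : ∀ j x, q (j + 1) x = r j (q j x)) (f : X → 𝕜)
    {N i j : ℕ} (hij : i < j) (hiN : i ≤ N) {x y : X} (h : q i x = q i y) :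
    piece μ q f N j x = piece μ q f N j y := by
  unfold piece
  rw [martingale_eq hr f hij h, martingale_eq hr f (hij.trans j.lt_succ_self) h,
    martingale_eq hr f (Nat.lt_succ_of_le hiN) h]

theorem integral_piece_eq_zero (hq : ∀ i, Measurable (q i)) (hfin : ∀ j i, μ (q j ⁻¹' {i}) < ∞)
    {f : X → 𝕜} (hf : MemLp f 2 μ) {N j : ℕ} (hj : j ≤ N) (i : ι) :
    ∫ x in q j ⁻¹' {i}, piece μ q f N j x ∂μ = 0 := by
  simp only [piece, if_pos hj]
  exact integral_fiber_sub_fiberAverage (hq j) (hfin j) (memLp_martingale hq hfin hf j) i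

theorem sum_piece (f : X → 𝕜) {N k : ℕ} (hk : k ≤ N + 1) (x : X) :
    ∑ j ∈ Finset.Ico k (N + 2), piece μ q f N j x = martingale μ q f k x := by
  rw [Finset.sum_Ico_succ_top (by omega)]
  have h1 : piece μ q f N (N + 1) x = martingale μ q f (N + 1) x := by simp [piece]
  have h2 : ∑ j ∈ Finset.Ico k (N + 1), piece μ q f N j x =
      ∑ j ∈ Finset.Ico k (N + 1), (martingale μ q f j x - martingale μ q f (j + 1) x) := by
    refine Finset.sum_congr rfl fun j hj => ?_
    rw [piece, if_pos (by have := (Finset.mem_Ico.1 hj).2; omega)]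
  have h3 := Finset.sum_Ico_sub (fun j => martingale μ q f j x) hk
  have h4 : ∑ j ∈ Finset.Ico k (N + 1), (martingale μ q f j x - martingale μ q f (j + 1) x) =
      -(martingale μ q f (N + 1) x - martingale μ q f k x) := by
    rw [← h3, ← Finset.sum_neg_distrib]
    simp only [neg_sub]
  rw [h1, h2, h4]
  ring

theorem sum_lintegral_piece_sq (hq : ∀ i, Measurable (q i)) (hfin : ∀ j i, μ (q j ⁻¹' {i}) < ∞)
    {f : X → 𝕜} (hf : MemLp f 2 μ) (N : ℕ) :
    ∑ j ∈ Finset.range (N + 2), ∫⁻ x, ‖piece μ q f N j x‖ₑ ^ 2 ∂μ = ∫⁻ x, ‖f x‖ₑ ^ 2 ∂μ := by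
  have key : ∀ m, ∑ j ∈ Finset.range m,
      ∫⁻ x, ‖martingale μ q f j x - martingale μ q f (j + 1) x‖ₑ ^ 2 ∂μ +
        ∫⁻ x, ‖martingale μ q f m x‖ₑ ^ 2 ∂μ = ∫⁻ x, ‖f x‖ₑ ^ 2 ∂μ := by
    intro m
    induction m with
    | zero => simp [martingale]
    | succ m ih =>
      rw [← ih, Finset.sum_range_succ, add_assoc,
        ← lintegral_fiberAverage_sq_add (hq m) (hfin m) (memLp_martingale hq hfin hf m),
        add_comm (∫⁻ x, ‖martingale μ q f m x - martingale μ q f (m + 1) x‖ₑ ^ 2 ∂μ)]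
      rfl
  rw [Finset.sum_range_succ, ← key (N + 1)]
  congr 1
  · refine Finset.sum_congr rfl fun j hj => ?_
    simp only [piece, if_pos (Nat.lt_succ_iff.1 (Finset.mem_range.1 hj))]
  · simp [piece]

/-- The dyadic Carleson embedding theorem. -/
theorem carleson_embedding (hq : ∀ i, Measurable (q i)) (hfin : ∀ j i, μ (q j ⁻¹' {i}) < ∞)
    {r : ℕ → ι → ι} (hr : ∀ j x, q (j + 1) x = r j (q j x)) {w : ℕ → X → ℝ≥0∞}
    (hw : ∀ k, Measurable (w k)) {m : ℕ}
    (hC : ∀ i < m, ∀ x, fiberLAverage μ (q i) (fun y => ∑ k ∈ Finset.range (i + 1), w k y) x ≤ 1)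
    {F : X → ℝ≥0∞} (hF : Measurable F) :
    ∑ k ∈ Finset.range m, ∫⁻ x, w k x * lmartingale μ q F (k + 1) x ^ 2 ∂μ ≤
      4 * ∫⁻ x, F x ^ 2 ∂μ := by
  -- `M (i + 1)` is the average over cells of level `i` of the weights up to `i`. By the tower
  -- property it arises from `M i + w i` by one averaging, and the packing hypothesis bounds it by
  -- `1`.
  set M : ℕ → X → ℝ≥0∞ := fun i => Nat.casesOn i (fun _ => 0)
    (fun i => fiberLAverage μ (q i) (fun y => ∑ k ∈ Finset.range (i + 1), w k y)) with hM
  have hM0 : M 0 = fun _ => 0 := rfl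
  have hMs : ∀ i, M (i + 1) =
    fiberLAverage μ (q i) (fun y => ∑ k ∈ Finset.range (i + 1), w k y) := fun i => rfl
  have hMm : ∀ i, Measurable (M i) := fun i => by
    cases i with
    | zero => exact measurable_const
    | succ i => exact measurable_fiberLAverage (hq i) _
  have hM1 : ∀ i ≤ m, ∀ x, M i x ≤ 1 := fun i hi x => by
    cases i with
    | zero => exact zero_le_one
    | succ i => exact hC i hi x
  have hstep : ∀ i, fiberLAverage μ (q i) (fun y => M i y + w i y) = M (i + 1) := fun i => by
    cases i with
    | zero => simp [hMs, hM0]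
    | succ i =>
      rw [hMs, hMs]
      ext x
      have h1 := fiberLAverage_fiberLAverage (μ := μ) (hq i) (hfin i) (hr i)
        (fun y => ∑ k ∈ Finset.range (i + 1), w k y) x
      have hWm : Measurable fun y => ∑ k ∈ Finset.range (i + 1), w k y :=
        Finset.measurable_sum _ fun k _ => hw k
      simp only [Finset.sum_range_succ _ (i + 1)]
      have hadd : ∀ a b : X → ℝ≥0∞, Measurable a →
          fiberLAverage μ (q (i + 1)) (fun y => a y + b y) x =
          fiberLAverage μ (q (i + 1)) a x + fiberLAverage μ (q (i + 1)) b x := fun a b ha => by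
        simp only [fiberLAverage, laverage]
        exact lintegral_add_left ha _
      rw [hadd _ _ (measurable_fiberLAverage (hq i) _), hadd _ _ hWm]
      exact congrArg (· + _) h1
  -- The energy `4 ∫ F_i² / (1 + M_i)` starts at `4 ∫ F²`, and each averaging lowers it by at least
  -- the next term of the Carleson sum.
  have key : ∀ i ≤ m, ∑ k ∈ Finset.range i, ∫⁻ x, w k x * lmartingale μ q F (k + 1) x ^ 2 ∂μ +
      4 * ∫⁻ x, lmartingale μ q F i x ^ 2 * (1 + M i x)⁻¹ ∂μ ≤ 4 * ∫⁻ x, F x ^ 2 ∂μ := by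
    intro i
    induction i with
    | zero => intro _; simp [lmartingale, hM0]
    | succ i ih =>
      intro hi
      refine le_trans ?_ (ih (by omega))
      rw [Finset.sum_range_succ, add_assoc]
      gcongr
      have := lintegral_mul_sq_fiberLAverage_add_le (hq i) (hfin i)
        (measurable_lmartingale (μ := μ) hq hF i).aemeasurable (hw i) (hMm i) (hM1 i (by omega))
        (by rw [hstep]; exact hM1 (i + 1) hi)
      rwa [hstep] at this
  exact le_self_add.trans (key m le_rfl)

end Martingale

/-! ### Summation of geometrically decaying terms -/

section Decay

/-- With truncated subtraction the exponent is `|k - j|`; each side of `k` contributes at most one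
geometric series. -/
theorem sum_pow_dist_le (τ : ℝ≥0∞) (k m : ℕ) :
    ∑ j ∈ Finset.range m, τ ^ (k - j + (j - k)) ≤ 2 * (1 - τ)⁻¹ := by
  have hgeo : ∀ l, ∑ j ∈ Finset.range l, τ ^ j ≤ (1 - τ)⁻¹ := fun l => by
    rw [← ENNReal.tsum_geometric]
    exact ENNReal.sum_le_tsum _
  calc ∑ j ∈ Finset.range m, τ ^ (k - j + (j - k))
      ≤ ∑ j ∈ Finset.range (k + 1 + m), τ ^ (k - j + (j - k)) :=
        Finset.sum_le_sum_of_subset (Finset.range_mono (by omega))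
    _ = ∑ j ∈ Finset.range (k + 1), τ ^ j + ∑ j ∈ Finset.range m, τ ^ (1 + j) := by
        rw [Finset.sum_range_add, ← Finset.sum_range_reflect (fun j => τ ^ j) (k + 1)]
        congr 1
        · refine Finset.sum_congr rfl fun j hj => ?_
          have := Finset.mem_range.1 hj
          congr 1; omega
        · refine Finset.sum_congr rfl fun j _ => ?_
          congr 1; omega
    _ ≤ (1 - τ)⁻¹ + (1 - τ)⁻¹ := by
        gcongr
        · exact hgeo _
        · refine le_trans ?_ (hgeo (m + 1))
          rw [Finset.sum_range_succ']
          simp only [add_comm 1]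
          exact le_self_add
    _ = _ := by ring

/-- Weighted Cauchy-Schwarz for finite sums of norms. -/
theorem enorm_sum_sq_le {E : Type*} [SeminormedAddCommGroup E] {κ : Type*} (S : Finset κ)
    (b : κ → E) {w : κ → ℝ≥0} (hw : ∀ j ∈ S, w j ≠ 0) :
    ‖∑ j ∈ S, b j‖ₑ ^ 2 ≤ (∑ j ∈ S, (w j : ℝ≥0∞)) * ∑ j ∈ S, (w j : ℝ≥0∞)⁻¹ * ‖b j‖ₑ ^ 2 := by
  have h1 : (∑ j ∈ S, ‖b j‖₊) ^ 2 ≤ (∑ j ∈ S, w j) * ∑ j ∈ S, (w j)⁻¹ * ‖b j‖₊ ^ 2 := by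
    refine Finset.sum_sq_le_sum_mul_sum_of_sq_le_mul S (fun j _ => zero_le) (fun j _ => zero_le)
      fun j hj => ?_
    rw [mul_inv_cancel_left₀ (hw j hj)]
  have h2 : ‖∑ j ∈ S, b j‖₊ ^ 2 ≤ (∑ j ∈ S, w j) * ∑ j ∈ S, (w j)⁻¹ * ‖b j‖₊ ^ 2 :=
    (pow_le_pow_left' (nnnorm_sum_le S b) 2).trans h1
  have h3 : ∑ j ∈ S, (w j : ℝ≥0∞)⁻¹ * ‖b j‖ₑ ^ 2 =
      ((∑ j ∈ S, (w j)⁻¹ * ‖b j‖₊ ^ 2 : ℝ≥0) : ℝ≥0∞) := by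
    push_cast
    refine Finset.sum_congr rfl fun j hj => ?_
    rw [ENNReal.coe_inv (hw j hj)]
    rfl
  rw [h3]
  simp only [enorm_eq_nnnorm]
  exact_mod_cast h2

end Decay

/-! ### Estimates at a single scale, outside the paraproduct -/

section Levels

variable {n : ℕ} {μ : Measure (Space n)} {𝕜 : Type*} [RCLike 𝕜] {α : ℝ} {C : ℝ≥0}
  {s : ℝ → Space n → Space n → 𝕜} [IsFiniteMeasureOnCompacts μ] {u : Space n} {δ : ℝ}

/-- The dyadic grids with meshes `δ 2 ^ i`. -/
noncomputable def grid (u : Space n) (δ : ℝ) (i : ℕ) : Space n → Fin n → ℤ :=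
  gridIndex u (δ * 2 ^ i)

theorem measurable_grid (u : Space n) (δ : ℝ) (i : ℕ) : Measurable (grid u δ i) :=
  measurable_gridIndex u _

theorem measure_grid_lt_top (u : Space n) (hδ : 0 < δ) (i : ℕ) (c : Fin n → ℤ) :
    μ (grid u δ i ⁻¹' {c}) < ∞ :=
  measure_gridIndex_lt_top μ u (by positivity) c

/-- The index of the parent of a grid cube. -/
def parentIndex (_ : ℕ) (c : Fin n → ℤ) : Fin n → ℤ := fun d => c d / 2

theorem grid_succ (u : Space n) (δ : ℝ) (i : ℕ) (x : Space n) :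
    grid u δ (i + 1) x = parentIndex i (grid u δ i x) := by
  rw [grid, pow_succ, ← mul_assoc, mul_comm _ (2 : ℝ), gridIndex_two_mul]
  rfl

/-- The range of `t` belonging to the level `k`. -/
def levelInterval (δ : ℝ) (k : ℕ) : Set ℝ := Set.Ico (δ * 2 ^ k / 4) (δ * 2 ^ k / 2)

theorem levelInterval_pos (hδ : 0 < δ) {k : ℕ} {t : ℝ} (ht : t ∈ levelInterval δ k) : 0 < t :=
  lt_of_lt_of_le (by positivity) ht.1

theorem lintegral_levelInterval_le (hδ : 0 < δ) (k : ℕ) :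
    ∫⁻ t in levelInterval δ k, ENNReal.ofReal (1 / t) ≤ 1 := by
  have h0 : 0 < δ * 2 ^ k / 4 := by positivity
  calc ∫⁻ t in levelInterval δ k, ENNReal.ofReal (1 / t)
      ≤ ∫⁻ _ in levelInterval δ k, ENNReal.ofReal (1 / (δ * 2 ^ k / 4)) := by
        refine setLIntegral_mono' measurableSet_Ico fun t ht => ENNReal.ofReal_le_ofReal ?_
        exact one_div_le_one_div_of_le h0 ht.1
    _ = 1 := by
        rw [setLIntegral_const, levelInterval, Real.volume_Ico, ← ENNReal.ofReal_mul (by positivity)]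
        have : 1 / (δ * 2 ^ k / 4) * (δ * 2 ^ k / 2 - δ * 2 ^ k / 4) = 1 := by
          field_simp; norm_num
        rw [this, ENNReal.ofReal_one]
    _ ≤ 1 := le_rfl

/-- The decay per dyadic step. -/
noncomputable def decay (α : ℝ) : ℝ≥0 := ((2 / 3 : ℝ) ^ α).toNNReal

theorem decay_ne_zero (α : ℝ) : decay α ≠ 0 := by
  rw [decay, Ne, Real.toNNReal_eq_zero, not_le]; positivity

theorem decay_lt_one (hα : 0 < α) : (decay α : ℝ≥0∞) < 1 := by
  have : decay α < 1 := by
    rw [decay, Real.toNNReal_lt_one]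
    exact Real.rpow_lt_one (by norm_num) (by norm_num) hα
  exact_mod_cast this

/-- The constant in the off-diagonal bounds. -/
noncomputable def offDiagConst (n : ℕ) (α : ℝ) : ℝ≥0 := ((48 * (n + 1) : ℝ) ^ α).toNNReal

theorem ofReal_rpow_le (hα : 0 < α) {a : ℝ} (ha : 0 ≤ a) (d : ℕ)
    (h : a ≤ 48 * (n + 1) * (2 / 3) ^ d) :
    ENNReal.ofReal (a ^ α) ≤ offDiagConst n α * (decay α : ℝ≥0∞) ^ d := by
  have h1 : a ^ α ≤ (48 * (n + 1) : ℝ) ^ α * ((2 / 3 : ℝ) ^ α) ^ d := by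
    refine (Real.rpow_le_rpow ha h hα.le).trans_eq ?_
    rw [Real.mul_rpow (by positivity) (by positivity), ← Real.rpow_natCast,
      ← Real.rpow_mul (by norm_num), mul_comm (d : ℝ), Real.rpow_mul (by norm_num),
      Real.rpow_natCast]
  refine (ENNReal.ofReal_le_ofReal h1).trans_eq ?_
  rw [ENNReal.ofReal_mul (by positivity), ENNReal.ofReal_pow (by positivity)]
  rfl

/-- The contribution of one piece of the martingale decomposition at the level `k`, without its
part in the paraproduct. -/
noncomputable def levelPiece (μ : Measure (Space n)) (s : ℝ → Space n → Space n → 𝕜)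
    (u : Space n) (δ : ℝ) (N k : ℕ) (t : ℝ) (f : Space n → 𝕜) (j : ℕ) (x : Space n) : 𝕜 :=
  theta μ s t (piece μ (grid u δ) f N j) x -
    if k < j then piece μ (grid u δ) f N j x * theta μ s t 1 x else 0

/-- The square of the bound for the part of `θ_t` outside the paraproduct. -/
noncomputable def levelConst (n : ℕ) (α : ℝ) (C : ℝ≥0) : ℝ≥0∞ :=
  4 * (C * offDiagConst n α * majorantBound α) ^ 2

variable (hs : IsMajorized μ α C s)
include hs

/-- For `j > k` the gain comes from good points and off-diagonal decay; for `j ≤ k` it comes from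
mean zero and smoothness, and goodness plays no role. -/
theorem IsMajorized.lintegral_levelPiece_le (hα : 0 < α) (hδ : 0 < δ) {N k j : ℕ}
    (hk : k ≤ N) (hj : j ≤ N + 1) {t : ℝ} (ht : t ∈ levelInterval δ k)
    {f : Space n → 𝕜} (hfm : Measurable f) (hf : MemLp f 2 μ) :
    ∫⁻ x in {x | IsGood u δ N k x}, ‖levelPiece μ s u δ N k t f j x‖ₑ ^ 2 ∂μ ≤
      4 * (C * (offDiagConst n α * (decay α : ℝ≥0∞) ^ (k - j + (j - k))) * majorantBound α) ^ 2 *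
        ∫⁻ x, ‖piece μ (grid u δ) f N j x‖ₑ ^ 2 ∂μ := by
  have ht0 := levelInterval_pos hδ ht
  have hpm := measurable_piece (μ := μ) (measurable_grid u δ) hfm N j
  have hpL := memLp_piece (measurable_grid u δ) (measure_grid_lt_top (μ := μ) u hδ) hf N j
  have hn : (1 : ℝ) ≤ n + 1 := by have : (0 : ℝ) ≤ n := n.cast_nonneg; linarith
  rcases lt_or_ge k j with hkj | hkj
  · obtain ⟨i, rfl⟩ := Nat.exists_eq_succ_of_ne_zero (Nat.ne_zero_of_lt hkj)
    have hki : k ≤ i := Nat.lt_succ_iff.1 hkj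
    have hiN : i ≤ N := by omega
    have hR : 0 < margin n k i * (δ * 2 ^ i) := by have := margin_pos n k i; positivity
    simp only [levelPiece, if_pos hkj]
    refine (hs.setLIntegral_theta_sub_mul_sq_le hα ht0 hR hpm hpL
      (measurableSet_isGood_right u δ N k) ?_).trans ?_
    · intro x hx y hxy
      exact piece_eq (grid_succ u δ) f (Nat.lt_succ_self i) hiN
        ((hx i hki hiN).gridIndex_eq (by positivity) hxy)
    · gcongr
      refine ofReal_rpow_le hα (by positivity) _ ?_
      -- The margin shrinks like `(3/4)^(i-k)` while the mesh grows like `2^(i-k)`, so `t / R`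
      -- decays like `(2/3)^(i-k)`; this is the rate in `decay`. The extra step from `i` to `j = i +
      -- 1` is paid for by `1/2 ≤ 2/3`.
      rw [div_le_iff₀ hR, show k - i.succ + (i.succ - k) = (i - k) + 1 by omega, margin]
      have e : (2 : ℝ) ^ i = 2 ^ (i - k) * 2 ^ k := by rw [← pow_add]; congr 1; omega
      have e2 : ((2 : ℝ) / 3) ^ (i - k) * ((3 / 4) ^ (i - k) * 2 ^ (i - k)) = 1 := by
        rw [← mul_pow, ← mul_pow]; norm_num
      calc t ≤ δ * 2 ^ k / 2 := ht.2.le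
        _ ≤ (2 / 3) * (δ * 2 ^ k) *
            ((2 / 3) ^ (i - k) * ((3 / 4) ^ (i - k) * 2 ^ (i - k))) := by
            rw [e2]
            have : 0 < δ * 2 ^ k := by positivity
            linarith
        _ = _ := by
            rw [e, pow_succ]; field_simp
  · simp only [levelPiece, if_neg (not_lt.2 hkj), sub_zero]
    refine (setLIntegral_le_lintegral _ _).trans ?_
    have h4 : ∀ a b : ℝ≥0∞, a ≤ b → a ^ 2 ≤ 4 * b ^ 2 := fun a b h =>
      (pow_le_pow_left' h 2).trans (le_mul_of_one_le_left' (by norm_num))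
    rw [show k - j + (j - k) = k - j by omega]
    have e : (2 : ℝ) ^ k = 2 ^ (k - j) * 2 ^ j := by rw [← pow_add]; congr 1; omega
    have hlj : 0 < δ * 2 ^ j := by positivity
    -- Three levels of separation give `t ≥ ℓ_k / 4 ≥ 2 ℓ_j`, so half a cube of level `j` is within
    -- the range `t / 2` of the smoothness estimate. For smaller gaps the plain `L²` bound suffices,
    -- because the decay factor is bounded below.
    by_cases h3 : 3 ≤ k - j
    · have h8 : (8 : ℝ) ≤ 2 ^ (k - j) := by
        calc (8 : ℝ) = 2 ^ 3 := by norm_num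
          _ ≤ _ := pow_le_pow_right₀ one_le_two h3
      have hd : δ * 2 ^ j / 2 < t / 2 := by
        have := ht.1
        rw [e] at this
        nlinarith
      refine (hs.lintegral_theta_sq_le_of_mean_zero hα (measurable_grid u δ j)
        (rep := gridCenter u (δ * 2 ^ j)) ht0 hd (fun y => dist_gridCenter_le u hlj y) hpm hpL
        (integral_piece_eq_zero (measurable_grid u δ) (measure_grid_lt_top u hδ) hf
          (hkj.trans hk))).trans ?_
      gcongr
      refine h4 _ _ ?_
      gcongr
      refine ofReal_rpow_le hα (by positivity) _ ?_
      rw [div_le_iff₀ ht0]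
      have e2 : ((2 : ℝ) / 3) ^ (k - j) * 2 ^ (k - j) = (4 / 3) ^ (k - j) := by
        rw [← mul_pow]; norm_num
      have e3 : (1 : ℝ) ≤ (4 / 3) ^ (k - j) := one_le_pow₀ (by norm_num)
      calc δ * 2 ^ j / 2 ≤ 48 * (n + 1) * ((4 / 3) ^ (k - j) * (δ * 2 ^ j / 4)) := by
            have : δ * 2 ^ j / 4 ≤ (4 / 3) ^ (k - j) * (δ * 2 ^ j / 4) :=
              le_mul_of_one_le_left (by positivity) e3
            nlinarith
        _ = 48 * (n + 1) * (2 / 3) ^ (k - j) * (δ * 2 ^ k / 4) := by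
            rw [e, ← e2]; ring
        _ ≤ _ := by
            gcongr
            exact ht.1
    · refine (hs.lintegral_theta_sq_le ht0 hpm).trans ?_
      gcongr
      refine h4 _ _ ?_
      gcongr
      refine le_mul_of_one_le_right' ?_
      have := ofReal_rpow_le (n := n) hα zero_le_one (k - j) ?_
      · simpa using this
      · have : (2 / 3 : ℝ) ^ 2 ≤ (2 / 3) ^ (k - j) :=
          pow_le_pow_of_le_one (by norm_num) (by norm_num) (by omega)
        nlinarith

/-- The subtracted products telescope: the pieces with `j > k` add up to the average of `f` over the
level-`k` cube, which is `martingale (k + 1)`. -/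
theorem IsMajorized.theta_eq_add_sum (hα : 0 < α) (hδ : 0 < δ) {N k : ℕ} (hk : k ≤ N) {t : ℝ}
    (ht : 0 < t) {f : Space n → 𝕜} (hf : MemLp f 2 μ) (x : Space n) :
    theta μ s t f x = martingale μ (grid u δ) f (k + 1) x * theta μ s t 1 x +
      ∑ j ∈ Finset.range (N + 2), levelPiece μ s u δ N k t f j x := by
  have hpL := memLp_piece (measurable_grid u δ) (measure_grid_lt_top (μ := μ) u hδ) hf N
  simp only [levelPiece]
  rw [Finset.sum_sub_distrib, ← Finset.sum_filter]
  have h1 : ∑ j ∈ Finset.range (N + 2), theta μ s t (piece μ (grid u δ) f N j) x =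
      theta μ s t f x := by
    simp only [theta]
    rw [← integral_finsetSum _ fun j _ => hs.integrable_mul hα ht x (hpL j)]
    refine integral_congr_ae (Filter.Eventually.of_forall fun y => ?_)
    simp only
    rw [← Finset.mul_sum, Finset.range_eq_Ico, sum_piece f (Nat.zero_le _)]
    rfl
  have h2 : (Finset.range (N + 2)).filter (k < ·) = Finset.Ico (k + 1) (N + 2) := by
    ext j; simp only [Finset.mem_filter, Finset.mem_range, Finset.mem_Ico]; omega
  rw [h1, h2, ← Finset.sum_mul, sum_piece f (by omega)]
  ring

theorem IsMajorized.measurable_levelPiece {N k j : ℕ} {t : ℝ} {f : Space n → 𝕜}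
    (hfm : Measurable f) : Measurable (levelPiece μ s u δ N k t f j) := by
  have hpm := measurable_piece (μ := μ) (measurable_grid u δ) hfm N j
  have h1 : ∀ {g : Space n → 𝕜}, Measurable g → Measurable (theta μ s t g) := fun hg =>
    (hs.measurable_theta hg).comp measurable_prodMk_left
  unfold levelPiece
  split_ifs
  · exact (h1 hpm).sub (hpm.mul (h1 measurable_one))
  · exact (h1 hpm).sub measurable_const

theorem IsMajorized.setLIntegral_theta_sq_le (hα : 0 < α) (hδ : 0 < δ) {N k : ℕ} (hk : k ≤ N)
    {t : ℝ} (ht : t ∈ levelInterval δ k) {f : Space n → 𝕜} (hfm : Measurable f)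
    (hf : MemLp f 2 μ) :
    ∫⁻ x in {x | IsGood u δ N k x}, ‖theta μ s t f x‖ₑ ^ 2 ∂μ ≤
      2 * ∫⁻ x in {x | IsGood u δ N k x},
        ‖martingale μ (grid u δ) f (k + 1) x‖ₑ ^ 2 * ‖theta μ s t 1 x‖ₑ ^ 2 ∂μ +
      2 * (2 * (1 - (decay α : ℝ≥0∞))⁻¹ * levelConst n α C *
        ∑ j ∈ Finset.range (N + 2), (decay α : ℝ≥0∞) ^ (k - j + (j - k)) *
          ∫⁻ x, ‖piece μ (grid u δ) f N j x‖ₑ ^ 2 ∂μ) := by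
  have ht0 := levelInterval_pos hδ ht
  set G := {x | IsGood u δ N k x}
  set τ : ℝ≥0 := decay α with hτdef
  set d : ℕ → ℕ := fun j => k - j + (j - k) with hd
  have hτ : ∀ j, τ ^ d j ≠ 0 := fun j => pow_ne_zero _ (decay_ne_zero α)
  have hbm : ∀ j, Measurable fun x => ‖levelPiece μ s u δ N k t f j x‖ₑ ^ 2 := fun j =>
    (hs.measurable_levelPiece hfm).enorm.pow_const 2
  have hm1 : Measurable fun x =>
      ‖martingale μ (grid u δ) f (k + 1) x‖ₑ ^ 2 * ‖theta μ s t 1 x‖ₑ ^ 2 := by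
    refine ((measurable_martingale (measurable_grid u δ) hfm (k + 1)).enorm.pow_const 2).mul ?_
    exact ((hs.measurable_theta measurable_one).comp measurable_prodMk_left).enorm.pow_const 2
  have hsum : ∫⁻ x in G, ‖∑ j ∈ Finset.range (N + 2), levelPiece μ s u δ N k t f j x‖ₑ ^ 2 ∂μ ≤
      2 * (1 - (τ : ℝ≥0∞))⁻¹ * levelConst n α C *
        ∑ j ∈ Finset.range (N + 2), (τ : ℝ≥0∞) ^ d j *
          ∫⁻ x, ‖piece μ (grid u δ) f N j x‖ₑ ^ 2 ∂μ := by
    calc _ ≤ ∫⁻ x in G, (∑ j ∈ Finset.range (N + 2), ((τ ^ d j : ℝ≥0) : ℝ≥0∞)) *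
          ∑ j ∈ Finset.range (N + 2), ((τ ^ d j : ℝ≥0) : ℝ≥0∞)⁻¹ *
            ‖levelPiece μ s u δ N k t f j x‖ₑ ^ 2 ∂μ :=
          lintegral_mono fun x => enorm_sum_sq_le _ _ fun j _ => hτ j
      _ = (∑ j ∈ Finset.range (N + 2), ((τ ^ d j : ℝ≥0) : ℝ≥0∞)) *
          ∑ j ∈ Finset.range (N + 2), ((τ ^ d j : ℝ≥0) : ℝ≥0∞)⁻¹ *
            ∫⁻ x in G, ‖levelPiece μ s u δ N k t f j x‖ₑ ^ 2 ∂μ := by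
          rw [lintegral_const_mul _ (Finset.measurable_sum _ fun j _ => (hbm j).const_mul _),
            lintegral_finsetSum _ fun j _ => (hbm j).const_mul _]
          congr 1
          exact Finset.sum_congr rfl fun j _ => lintegral_const_mul _ (hbm j)
      _ ≤ (2 * (1 - (τ : ℝ≥0∞))⁻¹) *
          ∑ j ∈ Finset.range (N + 2), levelConst n α C * ((τ : ℝ≥0∞) ^ d j *
            ∫⁻ x, ‖piece μ (grid u δ) f N j x‖ₑ ^ 2 ∂μ) := by
          refine mul_le_mul' ?_ (Finset.sum_le_sum fun j hj => ?_)
          · simpa using sum_pow_dist_le (τ : ℝ≥0∞) k (N + 2)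
          · have hj' : j ≤ N + 1 := Nat.lt_succ_iff.1 (Finset.mem_range.1 hj)
            refine (mul_le_mul' le_rfl
              (hs.lintegral_levelPiece_le hα hδ hk hj' ht hfm hf)).trans_eq ?_
            -- The squared bound carries `τ ^ (2 d j)`; the weight from Cauchy-Schwarz consumes one
            -- half and the other remains summable.
            have e : ((τ ^ d j : ℝ≥0) : ℝ≥0∞)⁻¹ * ((τ : ℝ≥0∞) ^ d j) = 1 := by
              rw [ENNReal.coe_pow]
              exact ENNReal.inv_mul_cancel (by exact_mod_cast hτ j)
                (ENNReal.pow_ne_top ENNReal.coe_ne_top)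
            set I := ∫⁻ x, ‖piece μ (grid u δ) f N j x‖ₑ ^ 2 ∂μ
            calc _ = ((τ ^ d j : ℝ≥0) : ℝ≥0∞)⁻¹ * ((τ : ℝ≥0∞) ^ d j) * (levelConst n α C *
                  ((τ : ℝ≥0∞) ^ d j * I)) := by simp only [levelConst, ← hτdef, hd]; ring
              _ = _ := by rw [e, one_mul]
      _ = _ := by rw [← Finset.mul_sum]; ring
  calc ∫⁻ x in G, ‖theta μ s t f x‖ₑ ^ 2 ∂μ
      ≤ ∫⁻ x in G, (2 * (‖martingale μ (grid u δ) f (k + 1) x‖ₑ ^ 2 * ‖theta μ s t 1 x‖ₑ ^ 2) +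
          2 * ‖∑ j ∈ Finset.range (N + 2), levelPiece μ s u δ N k t f j x‖ₑ ^ 2) ∂μ := by
        refine lintegral_mono fun x => ?_
        rw [hs.theta_eq_add_sum (u := u) hα hδ hk ht0 hf x, ← mul_pow, ← enorm_mul]
        rw [← mul_add]
        exact (pow_le_pow_left' (enorm_add_le _ _) 2).trans (add_sq_le_two_mul _ _)
    _ ≤ _ := by
        rw [lintegral_add_left (hm1.const_mul 2), lintegral_const_mul _ hm1,
          lintegral_const_mul' _ _ (by simp)]
        gcongr

end Levels

/-! ### The Carleson packing condition from testing -/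

section Paraproduct

variable {n : ℕ} {μ : Measure (Space n)} {𝕜 : Type*} [RCLike 𝕜] {α : ℝ} {C : ℝ≥0}
  {s : ℝ → Space n → Space n → 𝕜} [IsFiniteMeasureOnCompacts μ] {u : Space n} {δ : ℝ}

theorem sum_setLIntegral_levelInterval (hδ : 0 < δ) (Φ : ℝ → ℝ≥0∞) (m : ℕ) :
    ∑ k ∈ Finset.range m, ∫⁻ t in levelInterval δ k, Φ t =
      ∫⁻ t in Set.Ico (δ / 4) (δ * 2 ^ m / 4), Φ t := by
  induction m with
  | zero => simp
  | succ m ih =>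
    have h1 : δ / 4 ≤ δ * 2 ^ m / 4 := by
      have : (1 : ℝ) ≤ 2 ^ m := one_le_pow₀ one_le_two
      gcongr
      exact le_mul_of_one_le_right hδ.le this
    have h2 : δ * 2 ^ m / 4 ≤ δ * 2 ^ (m + 1) / 4 := by
      rw [pow_succ]
      have : 0 < δ * 2 ^ m := by positivity
      linarith
    have e : δ * 2 ^ (m + 1) / 4 = δ * 2 ^ m / 2 := by rw [pow_succ]; ring
    rw [Finset.sum_range_succ, ih, ← Set.Ico_union_Ico_eq_Ico h1 h2,
      lintegral_union measurableSet_Ico, levelInterval, e]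
    rw [Set.disjoint_left]
    intro t ht ht'
    exact absurd ht.2 (not_lt.2 ht'.1)

/-- The density of the Carleson measure at the level `k`. -/
noncomputable def carlesonWeight (μ : Measure (Space n)) (s : ℝ → Space n → Space n → 𝕜)
    (u : Space n) (δ : ℝ) (N k : ℕ) : Space n → ℝ≥0∞ :=
  {x | IsGood u δ N k x}.indicator fun x =>
    ∫⁻ t in levelInterval δ k, ‖theta μ s t 1 x‖ₑ ^ 2 * ENNReal.ofReal (1 / t)

/-- The constant in the Carleson condition. -/
noncomputable def carlesonConst (n : ℕ) (α : ℝ) (C T : ℝ≥0) : ℝ≥0∞ :=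
  1 + 2 * T + levelConst n α C * (1 - (decay α : ℝ≥0∞))⁻¹

variable (hs : IsMajorized μ α C s)
include hs

theorem IsMajorized.measurable_density {g : Space n → 𝕜} (hg : Measurable g) :
    Measurable fun p : ℝ × Space n => ‖theta μ s p.1 g p.2‖ₑ ^ 2 * ENNReal.ofReal (1 / p.1) :=
  ((hs.measurable_theta hg).enorm.pow_const 2).mul (by fun_prop)

theorem IsMajorized.measurable_theta_slice {g : Space n → 𝕜} (hg : Measurable g) (t : ℝ) :
    Measurable (theta μ s t g) :=
  (hs.measurable_theta hg).comp measurable_prodMk_left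

theorem IsMajorized.measurable_levelDensity {g : Space n → 𝕜} (hg : Measurable g) (I : Set ℝ) :
    Measurable fun x => ∫⁻ t in I, ‖theta μ s t g x‖ₑ ^ 2 * ENNReal.ofReal (1 / t) :=
  (hs.measurable_density hg).lintegral_prod_left'

theorem IsMajorized.lintegral_levelDensity {g : Space n → 𝕜} (hg : Measurable g) (I : Set ℝ)
    {A : Set (Space n)} {φ : Space n → ℝ≥0∞} (hφ : Measurable φ) :
    ∫⁻ x in A, φ x * (∫⁻ t in I, ‖theta μ s t g x‖ₑ ^ 2 * ENNReal.ofReal (1 / t)) ∂μ =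
      ∫⁻ t in I, (∫⁻ x in A, φ x * ‖theta μ s t g x‖ₑ ^ 2 ∂μ) * ENNReal.ofReal (1 / t) := by
  have hd : Measurable fun p : Space n × ℝ =>
      ‖theta μ s p.2 g p.1‖ₑ ^ 2 * ENNReal.ofReal (1 / p.2) :=
    (((hs.measurable_theta hg).comp
      (f := fun p : Space n × ℝ => (p.2, p.1)) (by fun_prop)).enorm.pow_const 2).mul (by fun_prop)
  have hm : Measurable fun p : Space n × ℝ =>
      φ p.1 * (‖theta μ s p.2 g p.1‖ₑ ^ 2 * ENNReal.ofReal (1 / p.2)) :=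
    Measurable.mul (f := fun p : Space n × ℝ => φ p.1) (by fun_prop) hd
  calc _ = ∫⁻ x in A, (∫⁻ t in I, φ x *
        (‖theta μ s t g x‖ₑ ^ 2 * ENNReal.ofReal (1 / t))) ∂μ := by
        refine lintegral_congr fun x => ?_
        exact (lintegral_const_mul _ (hd.comp measurable_prodMk_left)).symm
    _ = _ := by
        rw [lintegral_lintegral_swap (f := fun x t =>
          φ x * (‖theta μ s t g x‖ₑ ^ 2 * ENNReal.ofReal (1 / t))) hm.aemeasurable]
        refine lintegral_congr fun t => ?_
        simp only [← mul_assoc]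
        rw [lintegral_mul_const' _ _ ENNReal.ofReal_ne_top]

theorem IsMajorized.measurable_carlesonWeight (N k : ℕ) :
    Measurable (carlesonWeight μ s u δ N k) :=
  (hs.measurable_levelDensity measurable_one _).indicator (measurableSet_isGood_right u δ N k)

/-- The testing condition implies the Carleson packing condition. -/
theorem IsMajorized.carleson_packing (hα : 0 < α) (hδ : 0 < δ) {T : ℝ≥0}
    (hT : ∀ (c : Space n) (ℓ : ℝ), 0 < ℓ →
      squareIntegral μ s (cube c ℓ) (Set.Ioo 0 ℓ) ((cube c ℓ).indicator 1) ≤ T * μ (cube c ℓ))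
    {N i : ℕ} (hi : i ≤ N) (c : Fin n → ℤ) :
    ∫⁻ x in grid u δ i ⁻¹' {c}, ∑ k ∈ Finset.range (i + 1), carlesonWeight μ s u δ N k x ∂μ ≤
      carlesonConst n α C T * μ (grid u δ i ⁻¹' {c}) := by
  have hl : 0 < δ * 2 ^ i := by positivity
  set ℓ := δ * 2 ^ i with hldef
  -- The closed test cube must lie inside the half-open grid cube `Q`, whose boundary may carry
  -- mass, so it is shrunk by `ρ`. This is half the smallest margin occurring at level `i`, hence
  -- all good points of `Q` remain in it, with a ball of half their own margin to spare.
  set ρ := margin n 0 i * ℓ / 2 with hρ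
  have hm0 := margin_pos n 0 i
  have hρℓ : 2 * ρ ≤ ℓ / 48 := by
    have := mul_le_mul_of_nonneg_right (margin_le n 0 i) hl.le
    linarith
  have hρ0 : 0 < ρ := by positivity
  set Q := grid u δ i ⁻¹' {c} with hQ
  set z := gridCenter u ℓ c
  set Qb := cube z (ℓ - 2 * ρ) with hQb
  have hQb' : Qb = Metric.closedBall z (ℓ / 2 - ρ) := by
    rw [hQb, cube]; congr 1; ring
  have hQbm : MeasurableSet Qb := by rw [hQb']; exact Metric.isClosed_closedBall.measurableSet
  have hQbQ : Qb ⊆ Q := by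
    intro y hy
    rw [hQb', Metric.mem_closedBall] at hy
    exact gridIndex_eq_of_dist_lt u hl (by linarith)
  set χ : Space n → 𝕜 := Qb.indicator 1
  have hχ : Measurable χ := measurable_one.indicator hQbm
  set τ : ℝ≥0∞ := (decay α : ℝ≥0∞) with hτ
  set E : ℝ≥0∞ := C * offDiagConst n α * majorantBound α with hE
  have hlevel : ∀ k ∈ Finset.range (i + 1), ∫⁻ x in Q, carlesonWeight μ s u δ N k x ∂μ ≤
      2 * (∫⁻ t in levelInterval δ k, (∫⁻ x in Qb, ‖theta μ s t χ x‖ₑ ^ 2 ∂μ) *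
        ENNReal.ofReal (1 / t)) + 2 * (E ^ 2 * μ Q) * τ ^ (i - k + (k - i)) := by
    intro k hk
    have hki : k ≤ i := Nat.lt_succ_iff.1 (Finset.mem_range.1 hk)
    set G := {x | IsGood u δ N k x} with hG
    have hGm : MeasurableSet G := measurableSet_isGood_right u δ N k
    have hinner : ∀ x ∈ G ∩ Q, Metric.ball x (margin n k i * ℓ / 2) ⊆ Qb := by
      intro x hx
      have h1 := hx.1 i hki hi
      have h2 : gridIndex u ℓ x = c := hx.2
      have h3 : margin n 0 i ≤ margin n k i := by
        rw [margin, margin]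
        gcongr ?_ * ?_
        exact pow_le_pow_of_le_one (by norm_num) (by norm_num) (by omega)
      have := h1.ball_subset (r := margin n k i * ℓ / 2) (ρ := ρ) (by
        rw [hρ]
        have := mul_le_mul_of_nonneg_right h3 hl.le
        linarith)
      rwa [h2, ← hQb'] at this
    have hR : 0 < margin n k i * ℓ / 2 := by have := margin_pos n k i; positivity
    have hGQ : G ∩ Q ⊆ Qb := fun x hx => hinner x hx (Metric.mem_ball_self hR)
    have hpt : ∀ t ∈ levelInterval δ k, ∀ x ∈ G ∩ Q, ‖theta μ s t 1 x‖ₑ ^ 2 ≤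
        2 * ‖theta μ s t χ x‖ₑ ^ 2 + 2 * (E ^ 2 * τ ^ (i - k + (k - i))) := by
      intro t ht x hx
      have ht0 := levelInterval_pos hδ ht
      have h1 := hs.enorm_theta_one_sub_le hα ht0 hR hQbm (hinner x hx)
      have h2 : ENNReal.ofReal ((t / (margin n k i * ℓ / 2)) ^ α) ≤
          offDiagConst n α * τ ^ (i - k) := by
        refine ofReal_rpow_le hα (by positivity) _ ?_
        rw [div_le_iff₀ hR, margin]
        have e : ℓ = δ * 2 ^ (i - k) * 2 ^ k := by
          rw [hldef, mul_assoc, ← pow_add]; congr 2; omega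
        have e2 : ((2 : ℝ) / 3) ^ (i - k) * ((3 / 4) ^ (i - k) * 2 ^ (i - k)) = 1 := by
          rw [← mul_pow, ← mul_pow]; norm_num
        calc t ≤ δ * 2 ^ k / 2 := ht.2.le
          _ = (δ * 2 ^ k / 2) * ((2 / 3) ^ (i - k) * ((3 / 4) ^ (i - k) * 2 ^ (i - k))) := by
              rw [e2, mul_one]
          _ = _ := by rw [e]; field_simp
      have h3 : ‖theta μ s t 1 x - theta μ s t χ x‖ₑ ^ 2 ≤ E ^ 2 * τ ^ (i - k + (k - i)) := by
        calc _ ≤ (C * (offDiagConst n α * τ ^ (i - k)) * majorantBound α) ^ 2 := by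
              refine pow_le_pow_left' (h1.trans ?_) 2
              gcongr
          _ = E ^ 2 * (τ ^ (i - k) * τ ^ (i - k)) := by rw [hE]; ring
          -- One of the two decay factors is discarded; the other is enough to sum over `k`.
          _ ≤ E ^ 2 * (τ ^ (i - k) * 1) := by
              gcongr
              exact pow_le_one' (decay_lt_one hα).le _
          _ = _ := by rw [mul_one, show i - k + (k - i) = i - k by omega]
      calc ‖theta μ s t 1 x‖ₑ ^ 2
          = ‖theta μ s t χ x + (theta μ s t 1 x - theta μ s t χ x)‖ₑ ^ 2 := by
            rw [add_sub_cancel]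
        _ ≤ (‖theta μ s t χ x‖ₑ + ‖theta μ s t 1 x - theta μ s t χ x‖ₑ) ^ 2 :=
            pow_le_pow_left' (enorm_add_le _ _) 2
        _ ≤ 2 * (‖theta μ s t χ x‖ₑ ^ 2 + ‖theta μ s t 1 x - theta μ s t χ x‖ₑ ^ 2) :=
            add_sq_le_two_mul _ _
        _ ≤ _ := by rw [mul_add]; gcongr
    have hχ2 : ∀ t, Measurable fun x => ‖theta μ s t χ x‖ₑ ^ 2 := fun t =>
      (hs.measurable_theta_slice hχ t).enorm.pow_const 2
    have hslice : ∀ t ∈ levelInterval δ k, ∫⁻ x in G ∩ Q, ‖theta μ s t 1 x‖ₑ ^ 2 ∂μ ≤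
        2 * ∫⁻ x in Qb, ‖theta μ s t χ x‖ₑ ^ 2 ∂μ +
          2 * (E ^ 2 * μ Q) * τ ^ (i - k + (k - i)) := by
      intro t ht
      calc _ ≤ ∫⁻ x in G ∩ Q, (2 * ‖theta μ s t χ x‖ₑ ^ 2 +
            2 * (E ^ 2 * τ ^ (i - k + (k - i)))) ∂μ :=
            setLIntegral_mono' (hGm.inter (measurable_grid u δ i (measurableSet_singleton c)))
              (hpt t ht)
        _ = 2 * ∫⁻ x in G ∩ Q, ‖theta μ s t χ x‖ₑ ^ 2 ∂μ +
            2 * (E ^ 2 * τ ^ (i - k + (k - i))) * μ (G ∩ Q) := by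
            rw [lintegral_add_left ((hχ2 t).const_mul 2), lintegral_const_mul _ (hχ2 t),
              setLIntegral_const]
        _ ≤ 2 * ∫⁻ x in Qb, ‖theta μ s t χ x‖ₑ ^ 2 ∂μ +
            2 * (E ^ 2 * τ ^ (i - k + (k - i))) * μ Q := by
            gcongr
            exact Set.inter_subset_right
        _ = _ := by ring
    have hswap := hs.lintegral_levelDensity measurable_one (levelInterval δ k) (A := G ∩ Q)
      (measurable_one (α := ℝ≥0∞))
    simp only [Pi.one_apply, one_mul] at hswap
    have hm1 : Measurable fun t => ∫⁻ x in Qb, ‖theta μ s t χ x‖ₑ ^ 2 ∂μ :=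
      ((hs.measurable_theta hχ).enorm.pow_const 2).lintegral_prod_right'
    have hm2 : Measurable fun t => (∫⁻ x in Qb, ‖theta μ s t χ x‖ₑ ^ 2 ∂μ) *
        ENNReal.ofReal (1 / t) := hm1.mul (by fun_prop)
    calc ∫⁻ x in Q, carlesonWeight μ s u δ N k x ∂μ
        = ∫⁻ t in levelInterval δ k, (∫⁻ x in G ∩ Q, ‖theta μ s t 1 x‖ₑ ^ 2 ∂μ) *
            ENNReal.ofReal (1 / t) := by
          rw [← hswap]
          exact setLIntegral_indicator hGm _
      _ ≤ ∫⁻ t in levelInterval δ k, (2 * ((∫⁻ x in Qb, ‖theta μ s t χ x‖ₑ ^ 2 ∂μ) *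
            ENNReal.ofReal (1 / t)) + 2 * (E ^ 2 * μ Q) * τ ^ (i - k + (k - i)) *
              ENNReal.ofReal (1 / t)) := by
          refine setLIntegral_mono' measurableSet_Ico fun t ht => ?_
          rw [← mul_assoc, ← add_mul]
          gcongr
          exact hslice t ht
      _ ≤ _ := by
          rw [lintegral_add_left (hm2.const_mul 2), lintegral_const_mul _ hm2,
            lintegral_const_mul _ (by fun_prop)]
          exact add_le_add le_rfl
            (mul_le_of_le_one_right' (lintegral_levelInterval_le hδ k))
  rw [lintegral_finsetSum _ fun k _ => hs.measurable_carlesonWeight N k]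
  refine (Finset.sum_le_sum hlevel).trans ?_
  rw [Finset.sum_add_distrib, ← Finset.mul_sum, ← Finset.mul_sum,
    sum_setLIntegral_levelInterval hδ]
  -- The levels `k ≤ i` only reach `t < ℓ / 2`, below the sidelength of the shrunken cube, so they
  -- fit in its Carleson box.
  have hsub : Set.Ico (δ / 4) (δ * 2 ^ (i + 1) / 4) ⊆ Set.Ioo 0 (ℓ - 2 * ρ) := by
    intro t ht
    refine ⟨lt_of_lt_of_le (by positivity) ht.1, ht.2.trans_le ?_⟩
    have : δ * 2 ^ (i + 1) / 4 = ℓ / 2 := by rw [hldef, pow_succ]; ring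
    linarith
  have htest : ∫⁻ t in Set.Ico (δ / 4) (δ * 2 ^ (i + 1) / 4),
      (∫⁻ x in Qb, ‖theta μ s t χ x‖ₑ ^ 2 ∂μ) * ENNReal.ofReal (1 / t) ≤ T * μ Q :=
    (lintegral_mono_set hsub).trans ((hT z (ℓ - 2 * ρ) (by linarith)).trans
      (mul_le_mul' le_rfl (measure_mono hQbQ)))
  calc _ ≤ 2 * (T * μ Q) + 2 * (E ^ 2 * μ Q) * (2 * (1 - τ)⁻¹) := by
        gcongr
        exact sum_pow_dist_le τ i (i + 1)
    _ = (2 * T + levelConst n α C * (1 - τ)⁻¹) * μ Q := by rw [levelConst, hE]; ring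
    _ ≤ _ := by
        rw [carlesonConst, add_assoc 1]
        exact mul_le_mul' le_add_self le_rfl

end Paraproduct

/-! ### Summation over scales, averaging over grids and the limit -/

section Global

variable {n : ℕ} {μ : Measure (Space n)} {𝕜 : Type*} [RCLike 𝕜] {α : ℝ} {C T : ℝ≥0}
  {s : ℝ → Space n → Space n → 𝕜} [IsFiniteMeasureOnCompacts μ] {δ : ℝ}

/-- The constant in the square function estimate on good points. -/
noncomputable def goodConst (n : ℕ) (α : ℝ) (C T : ℝ≥0) : ℝ≥0∞ :=
  8 * carlesonConst n α C T + 8 * (1 - (decay α : ℝ≥0∞))⁻¹ ^ 2 * levelConst n α C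

theorem levelConst_ne_top (hα : 0 < α) (n : ℕ) (C : ℝ≥0) : levelConst n α C ≠ ∞ :=
  ENNReal.mul_ne_top (by simp) (ENNReal.pow_ne_top (ENNReal.mul_ne_top
    (ENNReal.mul_ne_top ENNReal.coe_ne_top ENNReal.coe_ne_top) (majorantBound_lt_top hα).ne))

theorem inv_one_sub_decay_ne_top (hα : 0 < α) : (1 - (decay α : ℝ≥0∞))⁻¹ ≠ ∞ := by
  rw [Ne, ENNReal.inv_eq_top, tsub_eq_zero_iff_le, not_le]
  exact decay_lt_one hα

theorem carlesonConst_ne_top (hα : 0 < α) (n : ℕ) (C T : ℝ≥0) : carlesonConst n α C T ≠ ∞ :=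
  ENNReal.add_ne_top.2
    ⟨ENNReal.add_ne_top.2 ⟨by simp, ENNReal.mul_ne_top (by simp) ENNReal.coe_ne_top⟩,
      ENNReal.mul_ne_top (levelConst_ne_top hα n C) (inv_one_sub_decay_ne_top hα)⟩

theorem goodConst_ne_top (hα : 0 < α) (n : ℕ) (C T : ℝ≥0) : goodConst n α C T ≠ ∞ :=
  ENNReal.add_ne_top.2 ⟨ENNReal.mul_ne_top (by simp) (carlesonConst_ne_top hα n C T),
    ENNReal.mul_ne_top (ENNReal.mul_ne_top (by simp)
      (ENNReal.pow_ne_top (inv_one_sub_decay_ne_top hα))) (levelConst_ne_top hα n C)⟩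

/-- The testing condition over all cubes. -/
def HasTesting (μ : Measure (Space n)) (s : ℝ → Space n → Space n → 𝕜) (T : ℝ≥0) : Prop :=
  ∀ (c : Space n) (ℓ : ℝ), 0 < ℓ →
    squareIntegral μ s (cube c ℓ) (Set.Ioo 0 ℓ) ((cube c ℓ).indicator 1) ≤ T * μ (cube c ℓ)

namespace IsMajorized

variable (hs : IsMajorized μ α C s)
include hs

theorem sum_carlesonWeight_le (hα : 0 < α) (hδ : 0 < δ) (hT : HasTesting μ s T) (u : Space n)
    (N : ℕ) {f : Space n → 𝕜} (hf : Measurable f) :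
    ∑ k ∈ Finset.range (N + 1), ∫⁻ x, carlesonWeight μ s u δ N k x *
      ‖martingale μ (grid u δ) f (k + 1) x‖ₑ ^ 2 ∂μ ≤
      4 * carlesonConst n α C T * ∫⁻ x, ‖f x‖ₑ ^ 2 ∂μ := by
  set D := carlesonConst n α C T
  have hDt : D ≠ ∞ := carlesonConst_ne_top hα n C T
  -- The summand `1` in `carlesonConst` is there for this: the weights are divided by `D` to meet
  -- the normalised packing hypothesis.
  have hD0 : D ≠ 0 := by simp [D, carlesonConst, add_assoc]
  have hw := fun k => hs.measurable_carlesonWeight (u := u) (δ := δ) N k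
  have hemb := carleson_embedding (μ := μ) (measurable_grid u δ) (measure_grid_lt_top u hδ)
    (grid_succ u δ) (w := fun k x => D⁻¹ * carlesonWeight μ s u δ N k x) (m := N + 1)
    (fun k => (hw k).const_mul _) ?_ hf.enorm
  · calc _ ≤ ∑ k ∈ Finset.range (N + 1), D * ∫⁻ x, D⁻¹ * carlesonWeight μ s u δ N k x *
          lmartingale μ (grid u δ) (fun y => ‖f y‖ₑ) (k + 1) x ^ 2 ∂μ := by
          refine Finset.sum_le_sum fun k _ => ?_
          rw [← lintegral_const_mul' _ _ hDt]
          refine lintegral_mono fun x => ?_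
          rw [mul_assoc D⁻¹, ← mul_assoc D, ENNReal.mul_inv_cancel hD0 hDt, one_mul]
          gcongr
          exact enorm_martingale_le f (k + 1) x
      _ ≤ D * (4 * ∫⁻ x, ‖f x‖ₑ ^ 2 ∂μ) := by
          rw [← Finset.mul_sum]
          exact mul_le_mul' le_rfl hemb
      _ = _ := by ring
  · intro i hi x
    have hp := hs.carleson_packing (u := u) hα hδ hT (Nat.lt_succ_iff.1 hi) (grid u δ i x)
    rw [fiberLAverage, setLAverage_eq]
    refine ENNReal.div_le_of_le_mul ?_
    simp only [← Finset.mul_sum]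
    rw [lintegral_const_mul' _ _ (ENNReal.inv_ne_top.2 hD0), one_mul]
    refine (mul_le_mul' le_rfl hp).trans ?_
    rw [← mul_assoc, ENNReal.inv_mul_cancel hD0 hDt, one_mul]

theorem sum_good_le (hα : 0 < α) (hδ : 0 < δ) (hT : HasTesting μ s T) (u : Space n)
    (N : ℕ) {f : Space n → 𝕜} (hfm : Measurable f) (hf : MemLp f 2 μ) :
    ∑ k ∈ Finset.range (N + 1), ∫⁻ t in levelInterval δ k,
      (∫⁻ x in {x | IsGood u δ N k x}, ‖theta μ s t f x‖ₑ ^ 2 ∂μ) * ENNReal.ofReal (1 / t) ≤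
      goodConst n α C T * ∫⁻ x, ‖f x‖ₑ ^ 2 ∂μ := by
  set τ : ℝ≥0∞ := (decay α : ℝ≥0∞) with hτ
  set H : ℕ → ℝ≥0∞ := fun j => ∫⁻ x, ‖piece μ (grid u δ) f N j x‖ₑ ^ 2 ∂μ with hH
  set Kc : ℝ≥0∞ := 4 * (1 - τ)⁻¹ * levelConst n α C with hKc
  have hlevel : ∀ k ∈ Finset.range (N + 1), ∫⁻ t in levelInterval δ k,
      (∫⁻ x in {x | IsGood u δ N k x}, ‖theta μ s t f x‖ₑ ^ 2 ∂μ) * ENNReal.ofReal (1 / t) ≤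
      2 * ∫⁻ x, carlesonWeight μ s u δ N k x * ‖martingale μ (grid u δ) f (k + 1) x‖ₑ ^ 2 ∂μ +
      Kc * ∑ j ∈ Finset.range (N + 2), τ ^ (j - k + (k - j)) * H j := by
    intro k hk
    have hkN : k ≤ N := Nat.lt_succ_iff.1 (Finset.mem_range.1 hk)
    set G := {x | IsGood u δ N k x}
    have hGm : MeasurableSet G := measurableSet_isGood_right u δ N k
    have hφ : Measurable fun x => ‖martingale μ (grid u δ) f (k + 1) x‖ₑ ^ 2 :=
      (measurable_martingale (measurable_grid u δ) hfm (k + 1)).enorm.pow_const 2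
    set Ψ : ℝ → ℝ≥0∞ := fun t =>
      ∫⁻ x in G, ‖martingale μ (grid u δ) f (k + 1) x‖ₑ ^ 2 * ‖theta μ s t 1 x‖ₑ ^ 2 ∂μ with hΨ
    have hΨm : Measurable Ψ := by
      have : Measurable fun p : ℝ × Space n =>
          ‖martingale μ (grid u δ) f (k + 1) p.2‖ₑ ^ 2 * ‖theta μ s p.1 1 p.2‖ₑ ^ 2 :=
        (hφ.comp measurable_snd).mul ((hs.measurable_theta measurable_one).enorm.pow_const 2)
      exact this.lintegral_prod_right'
    have hΨm' : Measurable fun t => Ψ t * ENNReal.ofReal (1 / t) := hΨm.mul (by fun_prop)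
    have hΨint : ∫⁻ t in levelInterval δ k, Ψ t * ENNReal.ofReal (1 / t) =
        ∫⁻ x, carlesonWeight μ s u δ N k x *
          ‖martingale μ (grid u δ) f (k + 1) x‖ₑ ^ 2 ∂μ := by
      rw [← hs.lintegral_levelDensity measurable_one (levelInterval δ k) (A := G) hφ,
        ← lintegral_indicator hGm]
      refine lintegral_congr fun x => ?_
      by_cases hx : x ∈ G
      · rw [carlesonWeight, Set.indicator_of_mem hx, Set.indicator_of_mem hx, mul_comm]
      · rw [carlesonWeight, Set.indicator_of_notMem hx, Set.indicator_of_notMem hx, zero_mul]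
    set Sk := ∑ j ∈ Finset.range (N + 2), τ ^ (j - k + (k - j)) * H j with hS
    have hpt : ∀ t ∈ levelInterval δ k, ∫⁻ x in G, ‖theta μ s t f x‖ₑ ^ 2 ∂μ ≤
        2 * Ψ t + Kc * Sk := by
      intro t ht
      refine (hs.setLIntegral_theta_sq_le hα hδ hkN ht hfm hf).trans_eq ?_
      rw [hKc, hS]
      simp only [add_comm (k - _)]
      ring
    calc _ ≤ ∫⁻ t in levelInterval δ k, (2 * (Ψ t * ENNReal.ofReal (1 / t)) +
          Kc * Sk * ENNReal.ofReal (1 / t)) := by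
          refine setLIntegral_mono' measurableSet_Ico fun t ht => ?_
          rw [← mul_assoc, ← add_mul]
          exact mul_le_mul' (hpt t ht) le_rfl
      _ ≤ _ := by
          rw [lintegral_add_left (hΨm'.const_mul 2), lintegral_const_mul _ hΨm',
            lintegral_const_mul _ (by fun_prop), hΨint]
          exact add_le_add le_rfl (mul_le_of_le_one_right' (lintegral_levelInterval_le hδ k))
  refine (Finset.sum_le_sum hlevel).trans ?_
  -- Summing over `k` first leaves a geometric series for each piece, and orthogonality then sums
  -- the energies of the pieces to that of `f`.
  rw [Finset.sum_add_distrib, ← Finset.mul_sum, ← Finset.mul_sum, Finset.sum_comm]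
  have hHsum : ∑ j ∈ Finset.range (N + 2), H j = ∫⁻ x, ‖f x‖ₑ ^ 2 ∂μ :=
    sum_lintegral_piece_sq (measurable_grid u δ) (measure_grid_lt_top u hδ) hf N
  calc _ ≤ 2 * (4 * carlesonConst n α C T * ∫⁻ x, ‖f x‖ₑ ^ 2 ∂μ) +
        Kc * ∑ j ∈ Finset.range (N + 2), 2 * (1 - τ)⁻¹ * H j := by
        refine add_le_add (mul_le_mul' le_rfl (hs.sum_carlesonWeight_le hα hδ hT u N hfm))
          (mul_le_mul' le_rfl (Finset.sum_le_sum fun j _ => ?_))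
        rw [← Finset.sum_mul]
        exact mul_le_mul' (sum_pow_dist_le τ j (N + 1)) le_rfl
    _ = _ := by
        rw [← Finset.mul_sum, hHsum, goodConst, hKc]; ring

theorem squareIntegral_truncated_le (hα : 0 < α) (hδ : 0 < δ) (hT : HasTesting μ s T)
    (N : ℕ) {f : Space n → 𝕜} (hfm : Measurable f) (hf : MemLp f 2 μ) :
    squareIntegral μ s Set.univ (Set.Ico (δ / 4) (δ * 2 ^ (N + 1) / 4)) f ≤
      2 * goodConst n α C T * ∫⁻ x, ‖f x‖ₑ ^ 2 ∂μ := by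
  set P := shiftMeasure n (δ * 2 ^ N) with hP
  have : IsProbabilityMeasure P := isProbabilityMeasure_shiftMeasure (by positivity)
  set Φ : ℕ → Space n → ℝ≥0∞ := fun k x =>
    ∫⁻ t in levelInterval δ k, ‖theta μ s t f x‖ₑ ^ 2 * ENNReal.ofReal (1 / t) with hΦ
  have hΦm : ∀ k, Measurable (Φ k) := fun k => hs.measurable_levelDensity hfm _
  have hswap : ∀ k (A : Set (Space n)), ∫⁻ t in levelInterval δ k,
      (∫⁻ x in A, ‖theta μ s t f x‖ₑ ^ 2 ∂μ) * ENNReal.ofReal (1 / t) = ∫⁻ x in A, Φ k x ∂μ := by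
    intro k A
    have := hs.lintegral_levelDensity hfm (levelInterval δ k) (A := A)
      (measurable_one (α := ℝ≥0∞))
    simp only [Pi.one_apply, one_mul] at this
    exact this.symm
  set Θ : ℕ → Space n × Space n → ℝ≥0∞ := fun k =>
    {p : Space n × Space n | IsGood p.1 δ N k p.2}.indicator fun p => Φ k p.2 with hΘ
  have hΘm : ∀ k, Measurable (Θ k) := fun k =>
    ((hΦm k).comp measurable_snd).indicator (measurableSet_isGood δ N k)
  have hslice : ∀ k u, ∫⁻ x, Θ k (u, x) ∂μ = ∫⁻ x in {x | IsGood u δ N k x}, Φ k x ∂μ := by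
    intro k u
    rw [← lintegral_indicator (measurableSet_isGood_right u δ N k)]
    rfl
  -- `Φ k` does not depend on the shift, so by Tonelli restricting to good points multiplies its
  -- density at `x` by the probability that `x` is good.
  have havg : ∀ k, ∫⁻ x, Φ k x ∂μ ≤ 2 * ∫⁻ u, ∫⁻ x, Θ k (u, x) ∂μ ∂P := by
    intro k
    rw [lintegral_lintegral_swap (f := fun u x => Θ k (u, x)) (hΘm k).aemeasurable,
      ← lintegral_const_mul' _ _ (by simp)]
    refine lintegral_mono fun x => ?_
    have hm : MeasurableSet {u : Space n | IsGood u δ N k x} :=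
      measurable_prodMk_right (measurableSet_isGood δ N k)
    have e : ∫⁻ u, Θ k (u, x) ∂P = Φ k x * P {u | IsGood u δ N k x} := by
      rw [← setLIntegral_const, ← lintegral_indicator hm]
      rfl
    rw [e]
    calc Φ k x = 2 * (Φ k x * (1 / 2)) := by
          rw [mul_left_comm, one_div, ENNReal.mul_inv_cancel two_ne_zero (by simp), mul_one]
      _ ≤ _ := by
          gcongr
          exact half_le_shiftMeasure_isGood hδ N k x
  calc squareIntegral μ s Set.univ (Set.Ico (δ / 4) (δ * 2 ^ (N + 1) / 4)) f
      = ∑ k ∈ Finset.range (N + 1), ∫⁻ x, Φ k x ∂μ := by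
        rw [squareIntegral, ← sum_setLIntegral_levelInterval hδ]
        refine Finset.sum_congr rfl fun k _ => ?_
        rw [hswap k Set.univ, Measure.restrict_univ]
    _ ≤ ∑ k ∈ Finset.range (N + 1), 2 * ∫⁻ u, ∫⁻ x, Θ k (u, x) ∂μ ∂P :=
        Finset.sum_le_sum fun k _ => havg k
    _ = 2 * ∫⁻ u, ∑ k ∈ Finset.range (N + 1), ∫⁻ x, Θ k (u, x) ∂μ ∂P := by
        rw [← Finset.mul_sum, lintegral_finsetSum _ fun k _ => (hΘm k).lintegral_prod_right']
    _ ≤ 2 * ∫⁻ _, goodConst n α C T * ∫⁻ x, ‖f x‖ₑ ^ 2 ∂μ ∂P := by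
        gcongr with u
        simp only [hslice, ← hswap]
        exact hs.sum_good_le hα hδ hT u N hfm hf
    _ = _ := by
        rw [lintegral_const, measure_univ, mul_one, mul_assoc]

theorem squareIntegral_le (hα : 0 < α) (hT : HasTesting μ s T) {f : Space n → 𝕜}
    (hfm : Measurable f) (hf : MemLp f 2 μ) :
    squareIntegral μ s Set.univ (Set.Ioi 0) f ≤
      2 * goodConst n α C T * ∫⁻ x, ‖f x‖ₑ ^ 2 ∂μ := by
  -- These are the ranges of `t` for `δ = 2^(-p)` and `N = 2 p`, which exhaust `(0, ∞)`.
  set S : ℕ → Set ℝ := fun p => Set.Ico ((1 / 2 : ℝ) ^ p / 4) (2 ^ (p + 1) / 4) with hS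
  have hmono : Monotone S := by
    intro p p' h
    refine Set.Ico_subset_Ico ?_ ?_
    · gcongr ?_ / _
      exact pow_le_pow_of_le_one (by norm_num) (by norm_num) h
    · gcongr
      exact one_le_two
  have hU : Set.Ioi (0 : ℝ) = ⋃ p, S p := by
    ext t
    simp only [Set.mem_Ioi, Set.mem_iUnion, hS, Set.mem_Ico]
    constructor
    · intro ht
      obtain ⟨p, hp⟩ := exists_pow_lt_of_lt_one (y := (1 / 2 : ℝ)) (show 0 < 4 * t by positivity)
        (by norm_num)
      obtain ⟨p', hp'⟩ := pow_unbounded_of_one_lt (4 * t) (one_lt_two (α := ℝ))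
      refine ⟨max p p', ?_, ?_⟩
      · have : (1 / 2 : ℝ) ^ max p p' ≤ (1 / 2) ^ p :=
          pow_le_pow_of_le_one (by norm_num) (by norm_num) (le_max_left _ _)
        linarith
      · have : (2 : ℝ) ^ p' ≤ 2 ^ (max p p' + 1) :=
          pow_le_pow_right₀ one_le_two ((le_max_right _ _).trans (Nat.le_succ _))
        linarith
    · rintro ⟨p, hp, -⟩
      exact lt_of_lt_of_le (by positivity) hp
  rw [squareIntegral, hU, setLIntegral_iUnion_of_directed _ hmono.directed_le]
  refine iSup_le fun p => ?_
  have h := hs.squareIntegral_truncated_le (δ := (1 / 2 : ℝ) ^ p) hα (by positivity) hT (2 * p)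
    hfm hf
  have e : (1 / 2 : ℝ) ^ p * 2 ^ (2 * p + 1) = 2 ^ (p + 1) := by
    rw [two_mul, add_assoc, pow_add 2 p, ← mul_assoc, ← mul_pow]; norm_num
  rwa [e] at h

end IsMajorized

end Global

theorem IsUpperDoubling.isFiniteMeasureOnCompacts {n : ℕ} {μ : Measure (Space n)}
    {lam : Space n → ℝ → ℝ} {Cl : ℝ} (h : IsUpperDoubling μ lam Cl) :
    IsFiniteMeasureOnCompacts μ := by
  have : IsLocallyFiniteMeasure μ := ⟨fun x => ⟨Metric.ball x 1, Metric.ball_mem_nhds x one_pos,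
    (h.measure_ball_le x 1 one_pos).trans_lt ENNReal.ofReal_lt_top⟩⟩
  infer_instance

theorem theta_congr_ae {n : ℕ} {μ : Measure (Space n)} {𝕜 : Type*} [RCLike 𝕜]
    (s : ℝ → Space n → Space n → 𝕜) {f g : Space n → 𝕜} (h : f =ᵐ[μ] g) (t : ℝ) (x : Space n) :
    theta μ s t f x = theta μ s t g x :=
  integral_congr_ae (by filter_upwards [h] with y hy; rw [hy])

theorem squareIntegral_congr_kernel {n : ℕ} {μ : Measure (Space n)} {𝕜 : Type*} [RCLike 𝕜]
    {s s' : ℝ → Space n → Space n → 𝕜} (A : Set (Space n)) {I : Set ℝ} (hI : MeasurableSet I)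
    (h : ∀ t ∈ I, s t = s' t) (f : Space n → 𝕜) :
    squareIntegral μ s A I f = squareIntegral μ s' A I f := by
  refine setLIntegral_congr_fun hI fun t ht => ?_
  simp only [theta, h t ht]

end SquareFunction

/-- The constant `C` depends only on `n`, `α`, the doubling constant `Cl`, the kernel constant `K`
and the testing constant `T`. -/
theorem corollary1p2 (𝕜 : Type*) [RCLike 𝕜] (n : ℕ) (α : ℝ) (hα : 0 < α) (Cl K : ℝ) (T : ℝ≥0) :
    ∃ C : ℝ≥0, ∀ (μ : Measure (SquareFunction.Space n)) (lam : SquareFunction.Space n → ℝ → ℝ)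
      (s : ℝ → SquareFunction.Space n → SquareFunction.Space n → 𝕜),
      SquareFunction.IsUpperDoubling μ lam Cl →
      SquareFunction.IsSquareKernel lam α K s →
      (∀ (c : SquareFunction.Space n) (ℓ : ℝ), 0 < ℓ →
        SquareFunction.squareIntegral μ s (SquareFunction.cube c ℓ) (Set.Ioo 0 ℓ)
          ((SquareFunction.cube c ℓ).indicator 1) ≤ T * μ (SquareFunction.cube c ℓ)) →
      ∀ f : SquareFunction.Space n → 𝕜, MemLp f 2 μ →
        (∀ t, 0 < t → ∀ x, Integrable (fun y => s t x y * f y) μ) ∧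
        SquareFunction.squareIntegral μ s Set.univ (Set.Ioi 0) f ≤ C * eLpNorm f 2 μ ^ 2 := by
  open SquareFunction in
  set C₀ : ℝ≥0 := (|K| * dominationConst α Cl).toNNReal
  refine ⟨(2 * goodConst n α C₀ T).toNNReal, fun μ lam s hμ hs hT f hf => ?_⟩
  have := hμ.isFiniteMeasureOnCompacts
  have hs' := hs.isMajorized hμ hα
  set s' : ℝ → Space n → Space n → 𝕜 := fun t x y => if 0 < t then s t x y else 0
  have hss' : ∀ t, 0 < t → s t = s' t := fun t ht => by
    ext x y
    simp [s', ht]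
  refine ⟨fun t ht x => ?_, ?_⟩
  · rw [hss' t ht]
    exact hs'.integrable_mul hα ht x hf
  · have hT' : HasTesting μ s' T := fun c ℓ hℓ => by
      rw [← squareIntegral_congr_kernel _ measurableSet_Ioo fun t ht => hss' t ht.1]
      exact hT c ℓ hℓ
    -- The estimates need a Borel function; replacing `f` by one that is equal almost everywhere
    -- changes `θ_t f` at no point.
    set g := hf.aestronglyMeasurable.mk f
    have hfg : f =ᵐ[μ] g := hf.aestronglyMeasurable.ae_eq_mk
    have hgm : Measurable g := hf.aestronglyMeasurable.stronglyMeasurable_mk.measurable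
    have hg : MemLp g 2 μ := hf.ae_eq hfg
    rw [squareIntegral_congr_kernel _ measurableSet_Ioi fun t ht => hss' t ht,
      eLpNorm_congr_ae hfg, eLpNorm_two_sq, ENNReal.coe_toNNReal
        (ENNReal.mul_ne_top (by simp) (goodConst_ne_top hα n C₀ T))]
    have := hs'.squareIntegral_le hα hT' hgm hg
    simp only [squareIntegral, theta_congr_ae s' hfg] at this ⊢
    exact this
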